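/- Let $\mathbf e=(e_1,\dots,e_{q_1})$ and $\mathbf f=(f_1,\dots,f_{q_2})$ be two non-empty finite sequences of positive integers that are disjoint ($e_i\neq f_j$ for all $i,j$) and satisfy $\sum_i e_i=\sum_j f_j$. For $n\ge 0$ put $\mathcal Q(n)=\frac{(e_1n)!\cdots(e_{q_1}n)!}{(f_1n)!\cdots(f_{q_2}n)!}$, for $x\in\mathbb R$ put $\Delta(x)=\sum_{i=1}^{q_1}\lfloor e_ix\rfloor-\sum_{j=1}^{q_2}\lfloor f_jx\rfloor$, and let $M=\max\{e_1,\dots,e_{q_1},f_1,\dots,f_{q_2}\}$. Let $H_n=\sum_{k=1}^n\frac1k$ and define the formal power series over $\mathbb Q$ $$F(z)=\sum_{n\ge 0}\mathcal Q(n)z^n,\qquad G(z)=\sum_{n\ge 1}\mathcal Q(n)\Big(\sum_{i=1}^{q_1}e_iH_{e_in}-\sum_{j=1}^{q_2}f_jH_{f_jn}\Big)z^n,\qquad q(z)=z\exp\big(G(z)/F(z)\big).$$ The number $\mathcal Q(n)$ is an integer for every $n\ge 0$ if and only if $\Delta(x)\ge 0$ for all $x\in[0,1]$. If this holds, then either $\Delta(x)\ge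 1$ for all $x\in[1/M,1)$, or $\Delta(x)=0$ for some $x\in[1/M,1)$, and: (i) if $\Delta(x)\ge 1$ for all $x\in[1/M,1)$, then $q(z)\in z\mathbb Z[[z]]$; (ii) if $\Delta(x)=0$ for some $x\in[1/M,1)$, then there are only finitely many primes $p$ such that $q(z)\in z\mathbb Z_p[[z]]$. -/

import Mathlib

open PowerSeries

/-- The factorial ratio `Q_{(e,f)}(n) = ∏ᵢ (eᵢ n)! / ∏ⱼ (fⱼ n)!`, a rational number. -/
def factorialRatio {q₁ q₂ : ℕ} (e : Fin q₁ → ℕ) (f : Fin q₂ → ℕ) (n : ℕ) : ℚ :=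
  (∏ i, (Nat.factorial (e i * n) : ℚ)) / ∏ j, (Nat.factorial (f j * n) : ℚ)

/-- The Landau function `Δ_{(e,f)}(x) = ∑ᵢ ⌊eᵢ x⌋ - ∑ⱼ ⌊fⱼ x⌋`. -/
noncomputable def landauDelta {q₁ q₂ : ℕ} (e : Fin q₁ → ℕ) (f : Fin q₂ → ℕ) (x : ℝ) : ℤ :=
  ∑ i, ⌊(e i : ℝ) * x⌋ - ∑ j, ⌊(f j : ℝ) * x⌋

/-- `M_{(e,f)}`, the largest of all the terms of the two sequences. -/
def maxTerm {q₁ q₂ : ℕ} (e : Fin q₁ → ℕ) (f : Fin q₂ → ℕ) : ℕ :=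
  max (Finset.univ.sup e) (Finset.univ.sup f)

/-- `F_{(e,f)}(z) = ∑_{n ≥ 0} Q(n) zⁿ`. -/
def seriesF {q₁ q₂ : ℕ} (e : Fin q₁ → ℕ) (f : Fin q₂ → ℕ) : ℚ⟦X⟧ :=
  PowerSeries.mk (factorialRatio e f)

/-- `G_{(e,f)}(z) = ∑_{n ≥ 1} Q(n) (∑ᵢ eᵢ H_{eᵢ n} - ∑ⱼ fⱼ H_{fⱼ n}) zⁿ`, where `H` denotes
harmonic numbers; the term of index `0` vanishes because `H₀ = 0`. -/
def seriesG {q₁ q₂ : ℕ} (e : Fin q₁ → ℕ) (f : Fin q₂ → ℕ) : ℚ⟦X⟧ :=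
  PowerSeries.mk fun n => factorialRatio e f n *
    (∑ i, (e i : ℚ) * harmonic (e i * n) - ∑ j, (f j : ℚ) * harmonic (f j * n))

theorem constantCoeff_seriesF {q₁ q₂ : ℕ} (e : Fin q₁ → ℕ) (f : Fin q₂ → ℕ) :
    constantCoeff (seriesF e f) = 1 := by
  simp [seriesF, factorialRatio, ← coeff_zero_eq_constantCoeff_apply]

theorem constantCoeff_seriesG {q₁ q₂ : ℕ} (e : Fin q₁ → ℕ) (f : Fin q₂ → ℕ) :
    constantCoeff (seriesG e f) = 0 := by
  simp [seriesG, ← coeff_zero_eq_constantCoeff_apply]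

/-- The inverse of `F` used below is a true inverse. -/
theorem seriesF_mul_inv {q₁ q₂ : ℕ} (e : Fin q₁ → ℕ) (f : Fin q₂ → ℕ) :
    seriesF e f * (seriesF e f)⁻¹ = 1 :=
  PowerSeries.mul_inv_cancel _ (by simp [constantCoeff_seriesF])

/-- `G / F` has no constant term, so it may be substituted into the exponential series. -/
theorem hasSubst_seriesG_mul_inv {q₁ q₂ : ℕ} (e : Fin q₁ → ℕ) (f : Fin q₂ → ℕ) :
    PowerSeries.HasSubst (seriesG e f * (seriesF e f)⁻¹) :=
  PowerSeries.HasSubst.of_constantCoeff_zero' (by simp [constantCoeff_seriesG])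

/-- The canonical coordinate `q_{(e,f)}(z) = z exp (G(z) / F(z))`, as a formal power series. -/
noncomputable def canonicalCoordinate {q₁ q₂ : ℕ} (e : Fin q₁ → ℕ) (f : Fin q₂ → ℕ) : ℚ⟦X⟧ :=
  X * (PowerSeries.exp ℚ).subst (seriesG e f * (seriesF e f)⁻¹)

/-- The rational power series `s` lies in `z ℤ[[z]]`. -/
def MemXMulInt (s : ℚ⟦X⟧) : Prop :=
  ∃ h : ℤ⟦X⟧, s = X * PowerSeries.map (Int.castRingHom ℚ) h

/-- The rational power series `s`, regarded over `ℚ_p`, lies in `z ℤ_p[[z]]`. -/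
def MemXMulPadicInt (p : ℕ) [Fact p.Prime] (s : ℚ⟦X⟧) : Prop :=
  ∃ h : ℤ_[p]⟦X⟧,
    PowerSeries.map (algebraMap ℚ ℚ_[p]) s = X * PowerSeries.map (algebraMap ℤ_[p] ℚ_[p]) h

/-! ### Dwork's formal congruences over an ultrametric field. -/

section DworkCongruence

open Finset

/-! By Legendre's formula the `p`-adic valuation of `Q(n)` is the sum of `Δ(n / p ^ l)` over `l ≥
1`, so `Δ ≥ 0` gives integrality. Conversely, for large `p` each value of `Δ` on `[0, 1)` is taken
at some `a / p` with `a < p`, where it equals the valuation of `Q(a)`.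

For (i), fix a prime `p`. By the Dieudonné–Dwork criterion (`norm_coeff_exp_subst_le_one`), `exp (G
/ F)` is `p`-integral once `p G(z) F(z^p) ≡ F(z) G(z^p)` modulo `p`
(`norm_coeff_seriesG_mul_expand_sub_le`). As `p H_{pN+r} ≡ H_N`, each coefficient reduces to sums of
`H_{aj}` against the antisymmetric terms `Q(v+pj) Q(K-j) - Q(j) Q(v+p(K-j))`. Summation by parts
over blocks of length `p ^ s` replaces `H_{aj}` by its value at the start of the block; the
denominators this creates are absorbed by Dwork's bound on block sums (`norm_blockSum_le`). One
counting function drives all estimates: the number of `l` with `{n / p ^ l} ≥ 1 / M`. It is at most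
the valuation of `Q(n)`, because `Δ ≥ 1` on `[1/M, 1)`, and it bounds the denominators that occur
(`dworkSystem_factorialRatio`).

For (ii), let `Δ(x) = 0` with `x` in `[1/M, 1)`. For large `p` choose `a < p` with `⌊c a / p⌋ = ⌊c
x⌋` for every term `c`. Then `Q(a)` is a `p`-adic unit, and `p`-integrality of `q` forces `p` to
divide the numerator of `W = ∑ eᵢ H_{⌊eᵢ x⌋} - ∑ fⱼ H_{⌊fⱼ x⌋}`, which does not depend on `p`
(`le_of_memXMulPadicInt`). Now `W` is the integral of `dΔ(t) / t` up to `x`; summed by parts it is a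
nonnegative combination of values of `Δ`, in which `Δ(1/M)` is nonzero by disjointness. So `W > 0`
(`floorHarmonicWeight_pos`), and only finitely many `p` remain. -/

theorem sum_range_mul_eq_sum_blocks {β : Type*} [AddCommMonoid β] (φ : ℕ → β) (a b : ℕ) :
    ∑ i ∈ range (a * b), φ i = ∑ k ∈ range b, ∑ i ∈ range a, φ (i + a * k) := by
  induction b with
  | zero => simp
  | succ b ih =>
    rw [Nat.mul_succ, sum_range_add, ih, sum_range_succ]
    simp only [add_comm]

/-- `n`, read as a block of `s` digits in base `p`, has no bad block of leading digits. -/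
def GoodDigits (p : ℕ) (Bad : ℕ → ℕ → Prop) : ℕ → ℕ → Prop
  | 0, _ => True
  | s + 1, n => GoodDigits p Bad s (n / p) ∧ ¬ Bad n (s + 1)

variable {𝕜 : Type*} [NormedField 𝕜]

/-- The terms whose block sums satisfy Dwork's congruences. -/
def crossTerm (A : ℕ → 𝕜) (p a K j : ℕ) : 𝕜 :=
  if j ≤ K then A (a + p * j) * A (K - j) - A j * A (a + p * (K - j)) else 0

/-- The sum of the cross terms over the `m`-th block of length `p ^ s`. -/
def blockSum (A : ℕ → 𝕜) (p a K s m : ℕ) : 𝕜 :=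
  ∑ i ∈ range (p ^ s), crossTerm A p a K (i + p ^ s * m)

/-- The hypotheses of Dwork's theorem on formal congruences. -/
structure DworkSystem (p : ℕ) (π : ℝ) (A : ℕ → 𝕜) (γ : ℕ → ℝ) (Bad : ℕ → ℕ → Prop) : Prop where
  p_pos : 0 < p
  pi_nonneg : 0 ≤ π
  map_zero : A 0 = 1
  ne_zero : ∀ n, A n ≠ 0
  nonneg : ∀ n, 0 ≤ γ n
  le_one : ∀ n, γ n ≤ 1
  norm_le : ∀ n, ‖A n‖ ≤ γ n
  bad : ∀ n t m, n < p ^ t → Bad n t → γ (n + p ^ t * m) ≤ π ^ t * γ m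
  good : ∀ n s m, n < p ^ s → GoodDigits p Bad s n → ‖A (n + p ^ s * m) / A n‖ ≤ γ m
  ratio : ∀ n s m, n < p ^ (s + 1) → GoodDigits p Bad (s + 1) n →
    ‖A (n + p ^ (s + 1) * m) / A n - A (n / p + p ^ s * m) / A (n / p)‖ * γ n ≤ π ^ (s + 1) * γ m

/-- The terms change sign under `j ↦ K - j` and vanish beyond `K`. -/
theorem sum_crossTerm (A : ℕ → 𝕜) (p a : ℕ) {K N : ℕ} (h : K < N) :
    ∑ j ∈ range N, crossTerm A p a K j = 0 := by
  have h1 : ∑ j ∈ range N, crossTerm A p a K j = ∑ j ∈ range (K + 1), crossTerm A p a K j := by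
    symm
    apply sum_subset
    · intro x; simp; omega
    · intro x _ hx
      rw [crossTerm, if_neg (by simpa using hx)]
  rw [h1]
  have h2 : ∀ j ∈ range (K + 1), crossTerm A p a K j =
      A (a + p * j) * A (K - j) - A j * A (a + p * (K - j)) := fun j hj => by
    rw [crossTerm, if_pos (by simp at hj; omega)]
  rw [sum_congr rfl h2, sum_sub_distrib, sub_eq_zero,
    ← sum_range_reflect (fun j => A j * A (a + p * (K - j)))]
  refine sum_congr rfl fun j hj => ?_
  simp only [mem_range] at hj
  rw [show K + 1 - 1 - j = K - j by omega, show K - (K - j) = j by omega, mul_comm]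

theorem blockSum_zero (A : ℕ → 𝕜) (p a K m : ℕ) : blockSum A p a K 0 m = crossTerm A p a K m := by
  simp [blockSum]

theorem blockSum_succ (A : ℕ → 𝕜) (p a K s m : ℕ) :
    blockSum A p a K (s + 1) m = ∑ i ∈ range p, blockSum A p a K s (i + p * m) := by
  simp only [blockSum, pow_succ]
  rw [sum_range_mul_eq_sum_blocks]
  refine sum_congr rfl fun i _ => sum_congr rfl fun k _ => ?_
  congr 1; ring

theorem sum_blockSum (A : ℕ → 𝕜) (p a K s N : ℕ) :
    ∑ m ∈ range N, blockSum A p a K s m = ∑ j ∈ range (p ^ s * N), crossTerm A p a K j := by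
  rw [sum_range_mul_eq_sum_blocks]; rfl

theorem blockSum_eq_zero (A : ℕ → 𝕜) (p a : ℕ) {K s m : ℕ} (h : K < p ^ s * m) :
    blockSum A p a K s m = 0 :=
  sum_eq_zero fun i _ => by rw [crossTerm, if_neg (by omega)]

variable [IsUltrametricDist 𝕜]

theorem norm_sub_le_of_ultra {x y : 𝕜} {C : ℝ} (hx : ‖x‖ ≤ C) (hy : ‖y‖ ≤ C) : ‖x - y‖ ≤ C :=
  sub_eq_add_neg x y ▸ (IsUltrametricDist.norm_add_le_max x (-y)).trans
    (max_le hx (by rwa [norm_neg]))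

theorem norm_sub_le_trans {x y z : 𝕜} {C : ℝ} (hx : ‖x - y‖ ≤ C) (hy : ‖y - z‖ ≤ C) :
    ‖x - z‖ ≤ C := by
  have := (IsUltrametricDist.norm_add_le_max (x - y) (y - z)).trans (max_le hx hy)
  simpa using this

theorem norm_sum_le_of_ultra {ι : Type*} {t : Finset ι} {g : ι → 𝕜} {C : ℝ} (hC : 0 ≤ C)
    (h : ∀ i ∈ t, ‖g i‖ ≤ C) : ‖∑ i ∈ t, g i‖ ≤ C :=
  IsUltrametricDist.norm_sum_le_of_forall_le_of_nonneg hC h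

open Classical in
theorem sum_good_succ {β : Type*} [AddCommMonoid β] {p : ℕ} (hp : 0 < p) (Bad : ℕ → ℕ → Prop)
    (t : ℕ) (φ : ℕ → β) (ψ : ℕ → β)
    (h : ∀ u, φ u = ∑ i ∈ range p, ψ (i + p * u)) :
    ∑ u ∈ range (p ^ t), (if GoodDigits p Bad t u then φ u else 0) =
      ∑ j ∈ range (p ^ (t + 1)), (if GoodDigits p Bad t (j / p) then ψ j else 0) := by
  rw [pow_succ', sum_range_mul_eq_sum_blocks]
  refine sum_congr rfl fun u _ => ?_
  rw [h]
  have : ∀ i ∈ range p, (if GoodDigits p Bad t ((i + p * u) / p) then ψ (i + p * u) else 0) =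
      if GoodDigits p Bad t u then ψ (i + p * u) else 0 := fun i hi => by
    rw [Nat.add_mul_div_left _ _ hp, Nat.div_eq_of_lt (mem_range.1 hi), zero_add]
  rw [sum_congr rfl this]
  split_ifs <;> simp

namespace DworkSystem

variable {p : ℕ} {π : ℝ} {A : ℕ → 𝕜} {γ : ℕ → ℝ} {Bad : ℕ → ℕ → Prop}

-- Each block is cut into `p` smaller ones, `t` times. A bad sub-block may be dropped: `bad` turns
-- its inductive bound `π ^ (s - t + 1) * γ (n + p ^ t * m)` into the required one.
open Classical in
theorem blockSum_sub_sum_good (h : DworkSystem p π A γ Bad) {a K s m t : ℕ}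
    (ih : ∀ s' < s, ∀ m, ‖blockSum A p a K s' m‖ ≤ π ^ (s' + 1) * γ m) (hts : t ≤ s) :
    ‖blockSum A p a K s m - ∑ n ∈ range (p ^ t), (if GoodDigits p Bad t n then
      blockSum A p a K (s - t) (n + p ^ t * m) else 0)‖ ≤ π ^ (s + 1) * γ m := by
  have hC : 0 ≤ π ^ (s + 1) * γ m := mul_nonneg (pow_nonneg h.pi_nonneg _) (h.nonneg _)
  induction t with
  | zero => simpa [GoodDigits] using hC
  | succ t iht =>
    refine norm_sub_le_trans (iht (by omega)) ?_
    rw [sum_good_succ h.p_pos Bad t _ (fun n => blockSum A p a K (s - (t + 1)) (n + p ^ (t + 1) * m)),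
      ← sum_sub_distrib]
    · refine norm_sum_le_of_ultra hC fun n hn => ?_
      by_cases h1 : GoodDigits p Bad t (n / p)
      · by_cases h2 : Bad n (t + 1)
        · rw [if_pos h1, if_neg (by simp [GoodDigits, h2]), sub_zero]
          refine (ih _ (by omega) _).trans ?_
          have := h.bad n (t + 1) m (mem_range.1 hn) h2
          calc π ^ (s - (t + 1) + 1) * γ (n + p ^ (t + 1) * m)
              ≤ π ^ (s - (t + 1) + 1) * (π ^ (t + 1) * γ m) :=
                mul_le_mul_of_nonneg_left this (pow_nonneg h.pi_nonneg _)
            _ = π ^ (s + 1) * γ m := by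
              rw [← mul_assoc, ← pow_add]; congr 2; omega
        · rw [if_pos h1, if_pos ⟨h1, h2⟩]; simpa using hC
      · rw [if_neg h1, if_neg (by simp [GoodDigits, h1])]; simpa using hC
    · intro u
      rw [show s - t = s - (t + 1) + 1 by omega, blockSum_succ]
      refine sum_congr rfl fun i _ => ?_
      congr 1; ring

-- The same refinement for the zeroth block, weighted by quotients of `A`. Replacing the quotient at
-- `n / p` by that at `n` costs what `ratio` allows if `n` is good; if `n` is bad, its block is
-- already small enough.
open Classical in
theorem sum_ratio_blockSum (h : DworkSystem p π A γ Bad) {a K s m r : ℕ}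
    (ih : ∀ s' < s, ∀ m, ‖blockSum A p a K s' m‖ ≤ π ^ (s' + 1) * γ m) (hrs : r ≤ s) :
    ‖∑ n ∈ range (p ^ r), (if GoodDigits p Bad r n then
      A (n + p ^ r * m) / A n * blockSum A p a K (s - r) n else 0) -
        A m * blockSum A p a K s 0‖ ≤ π ^ (s + 1) * γ m := by
  have hC : 0 ≤ π ^ (s + 1) * γ m := mul_nonneg (pow_nonneg h.pi_nonneg _) (h.nonneg _)
  induction r with
  | zero => simpa [GoodDigits, h.map_zero] using hC
  | succ r ihr =>
    refine norm_sub_le_trans ?_ (ihr (by omega))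
    rw [sum_good_succ h.p_pos Bad r _ (fun n => A (n / p + p ^ r * m) / A (n / p) *
      blockSum A p a K (s - (r + 1)) n), ← sum_sub_distrib]
    · refine norm_sum_le_of_ultra hC fun n hn => ?_
      have hS := ih (s - (r + 1)) (by omega) n
      by_cases h1 : GoodDigits p Bad r (n / p)
      · by_cases h2 : Bad n (r + 1)
        · rw [if_neg (by simp [GoodDigits, h2]), if_pos h1, zero_sub, norm_neg, norm_mul]
          have hg := h.good (n / p) r m
            (Nat.div_lt_of_lt_mul (by rw [← pow_succ']; exact mem_range.1 hn)) h1
          have hb := h.bad n (r + 1) 0 (mem_range.1 hn) h2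
          rw [mul_zero, add_zero] at hb
          have hb' : γ n ≤ π ^ (r + 1) :=
            hb.trans (mul_le_of_le_one_right (pow_nonneg h.pi_nonneg _) (h.le_one 0))
          calc _ ≤ γ m * (π ^ (s - (r + 1) + 1) * π ^ (r + 1)) :=
                mul_le_mul hg (hS.trans (mul_le_mul_of_nonneg_left hb'
                  (pow_nonneg h.pi_nonneg _))) (norm_nonneg _) (h.nonneg _)
            _ = _ := by rw [← pow_add, mul_comm]; congr 2; omega
        · rw [if_pos ⟨h1, h2⟩, if_pos h1, ← sub_mul, norm_mul]
          have hr := h.ratio n r m (mem_range.1 hn) ⟨h1, h2⟩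
          calc _ ≤ ‖A (n + p ^ (r + 1) * m) / A n - A (n / p + p ^ r * m) / A (n / p)‖ *
                (π ^ (s - (r + 1) + 1) * γ n) := mul_le_mul_of_nonneg_left hS (norm_nonneg _)
            _ = π ^ (s - (r + 1) + 1) * (‖A (n + p ^ (r + 1) * m) / A n -
                A (n / p + p ^ r * m) / A (n / p)‖ * γ n) := by ring
            _ ≤ π ^ (s - (r + 1) + 1) * (π ^ (r + 1) * γ m) :=
              mul_le_mul_of_nonneg_left hr (pow_nonneg h.pi_nonneg _)
            _ = _ := by rw [← mul_assoc, ← pow_add]; congr 2; omega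
      · rw [if_neg h1, if_neg (by simp [GoodDigits, h1])]; simpa using hC
    · intro u
      rw [show s - r = s - (r + 1) + 1 by omega, blockSum_succ, mul_sum]
      refine sum_congr rfl fun i hi => ?_
      rw [Nat.add_mul_div_left _ _ h.p_pos, Nat.div_eq_of_lt (mem_range.1 hi), zero_add]

/-- Shifting both `K` and the block index multiplies a block sum by `A m`, up to the expected
precision. -/
theorem blockSum_shift (h : DworkSystem p π A γ Bad) {a K s m : ℕ} (ha : a < p)
    (ih : ∀ s' < s, ∀ K m, ‖blockSum A p a K s' m‖ ≤ π ^ (s' + 1) * γ m) :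
    ‖blockSum A p a (K + p ^ s * m) s m - A m * blockSum A p a K s 0‖ ≤ π ^ (s + 1) * γ m := by
  classical
  have hC : 0 ≤ π ^ (s + 1) * γ m := mul_nonneg (pow_nonneg h.pi_nonneg _) (h.nonneg _)
  refine norm_sub_le_trans (h.blockSum_sub_sum_good (fun s' hs' => ih s' hs' _) le_rfl) ?_
  refine norm_sub_le_trans ?_ (h.sum_ratio_blockSum (fun s' hs' => ih s' hs' _) le_rfl)
  rw [← sum_sub_distrib]
  refine norm_sum_le_of_ultra hC fun n hn => ?_
  rw [Nat.sub_self, blockSum_zero, blockSum_zero]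
  by_cases h1 : GoodDigits p Bad s n
  · rw [if_pos h1, if_pos h1]
    unfold crossTerm
    by_cases hK : n ≤ K
    · rw [if_pos (by omega), if_pos hK]
      have hdiv : (a + p * n) / p = n := by
        rw [Nat.add_mul_div_left _ _ h.p_pos, Nat.div_eq_of_lt ha, zero_add]
      have hlt : a + p * n < p ^ (s + 1) := by
        have : p * (n + 1) ≤ p * p ^ s := Nat.mul_le_mul_left _ (mem_range.1 hn)
        rw [pow_succ']; linarith [Nat.mul_succ p n]
      have hidx : a + p * (n + p ^ s * m) = a + p * n + p ^ (s + 1) * m := by ring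
      -- The products containing `A (a + p * (K - n))` cancel, which leaves a factor governed by
      -- `bad` or by `ratio`.
      have hsplit : A (a + p * (n + p ^ s * m)) * A (K - n) -
          A (n + p ^ s * m) * A (a + p * (K - n)) -
          A (n + p ^ s * m) / A n * (A (a + p * n) * A (K - n) - A n * A (a + p * (K - n))) =
          (A (a + p * n + p ^ (s + 1) * m) - A (n + p ^ s * m) / A n * A (a + p * n)) *
            A (K - n) := by
        rw [hidx]; field_simp [h.ne_zero n]; ring
      rw [show K + p ^ s * m - (n + p ^ s * m) = K - n by omega, hsplit, norm_mul]
      refine (mul_le_of_le_one_right (norm_nonneg _) ((h.norm_le _).trans (h.le_one _))).trans ?_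
      by_cases h2 : Bad (a + p * n) (s + 1)
      · refine norm_sub_le_of_ultra ((h.norm_le _).trans (h.bad _ _ _ hlt h2)) ?_
        have hb := h.bad _ _ 0 hlt h2
        rw [mul_zero, add_zero] at hb
        rw [norm_mul, mul_comm]
        exact mul_le_mul ((h.norm_le _).trans (hb.trans (mul_le_of_le_one_right
          (pow_nonneg h.pi_nonneg _) (h.le_one 0)))) (h.good n s m (mem_range.1 hn) h1)
          (norm_nonneg _) (pow_nonneg h.pi_nonneg _)
      · have hr := h.ratio _ s m hlt ⟨by rwa [hdiv], h2⟩
        rw [hdiv] at hr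
        refine le_trans ?_ hr
        have : A (a + p * n + p ^ (s + 1) * m) - A (n + p ^ s * m) / A n * A (a + p * n) =
            (A (a + p * n + p ^ (s + 1) * m) / A (a + p * n) - A (n + p ^ s * m) / A n) *
              A (a + p * n) := by
          rw [sub_mul, div_mul_cancel₀ _ (h.ne_zero _)]
        rw [this, norm_mul]
        exact mul_le_mul_of_nonneg_left (h.norm_le _) (norm_nonneg _)
    · rw [if_neg (by omega), if_neg hK]; simpa using hC
  · rw [if_neg h1, if_neg h1]; simpa using hC

/-- Strong induction on `K`: all blocks together sum to zero, and by the shift congruence every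
later block is close to a multiple of the zeroth block for a smaller `K`. -/
theorem norm_blockSum_zero_le (h : DworkSystem p π A γ Bad) {a s : ℕ} (ha : a < p)
    (ih : ∀ s' < s, ∀ K m, ‖blockSum A p a K s' m‖ ≤ π ^ (s' + 1) * γ m) (K : ℕ) :
    ‖blockSum A p a K s 0‖ ≤ π ^ (s + 1) := by
  have hC : 0 ≤ π ^ (s + 1) := pow_nonneg h.pi_nonneg _
  induction K using Nat.strong_induction_on with
  | _ K ihK =>
  have hpos : 0 < p ^ s := pow_pos h.p_pos _
  have hlt : K < p ^ s * (K + 1) := by nlinarith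
  have hsum := sum_blockSum A p a K s (K + 1)
  rw [sum_crossTerm A p a hlt, sum_range_succ', ← eq_neg_iff_add_eq_zero, neg_eq_iff_eq_neg.symm]
    at hsum
  rw [← hsum, norm_neg]
  refine norm_sum_le_of_ultra hC fun m _ => ?_
  rcases lt_or_ge K (p ^ s * (m + 1)) with hK | hK
  · rw [blockSum_eq_zero A p a hK]; simpa using hC
  · have hpm : 0 < p ^ s * (m + 1) := by positivity
    have h1 := h.blockSum_shift (K := K - p ^ s * (m + 1)) (m := m + 1) ha ih
    rw [Nat.sub_add_cancel hK] at h1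
    have h2 := ihK (K - p ^ s * (m + 1)) (by omega)
    have h3 := norm_sub_le_trans (z := 0)
      (h1.trans (mul_le_of_le_one_right hC (h.le_one _))) (by
        rw [sub_zero, norm_mul]
        exact (mul_le_of_le_one_left (norm_nonneg _) ((h.norm_le _).trans (h.le_one _))).trans h2)
    simpa using h3

/-- Dwork's theorem on formal congruences. -/
theorem norm_blockSum_le (h : DworkSystem p π A γ Bad) {a : ℕ} (ha : a < p) (s K m : ℕ) :
    ‖blockSum A p a K s m‖ ≤ π ^ (s + 1) * γ m := by
  have hC : 0 ≤ π ^ (s + 1) * γ m := mul_nonneg (pow_nonneg h.pi_nonneg _) (h.nonneg _)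
  induction s using Nat.strong_induction_on generalizing K m with
  | _ s ih =>
  rcases lt_or_ge K (p ^ s * m) with hK | hK
  · rw [blockSum_eq_zero A p a hK]; simpa using hC
  · have h1 := h.blockSum_shift (K := K - p ^ s * m) (m := m) ha (fun s' hs' K m =>
      ih s' hs' K m (mul_nonneg (pow_nonneg h.pi_nonneg _) (h.nonneg _)))
    rw [Nat.sub_add_cancel hK] at h1
    have h2 := h.norm_blockSum_zero_le (s := s) ha (fun s' hs' K m =>
      ih s' hs' K m (mul_nonneg (pow_nonneg h.pi_nonneg _) (h.nonneg _))) (K - p ^ s * m)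
    have h3 := norm_sub_le_trans (z := 0) h1 (by
        rw [sub_zero, norm_mul, mul_comm]
        exact mul_le_mul h2 (h.norm_le _) (norm_nonneg _) (pow_nonneg h.pi_nonneg _))
    simpa using h3

/-- Summation by parts against the cross terms. -/
theorem norm_sum_mul_crossTerm_le (h : DworkSystem p π A γ Bad) (hp : 1 < p) {a : ℕ} (ha : a < p)
    (H : ℕ → 𝕜) (H0 : H 0 = 0)
    (hH : ∀ s k, ‖H (p ^ s * k) - H (p ^ (s + 1) * (k / p))‖ * γ k * π ^ s ≤ 1) (K : ℕ) :
    ‖∑ j ∈ range (K + 1), H j * crossTerm A p a K j‖ ≤ π := by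
  obtain ⟨r, hr⟩ : ∃ r, K + 1 ≤ p ^ r := ⟨K + 1, (Nat.lt_pow_self hp).le⟩
  have hext : ∑ j ∈ range (K + 1), H j * crossTerm A p a K j =
      ∑ j ∈ range (p ^ r), H j * crossTerm A p a K j := by
    apply sum_subset
    · intro x; simp; omega
    · intro x _ hx
      rw [crossTerm, if_neg (by simp at hx; omega), mul_zero]
  -- Level `s` freezes `H` at the start of each block of length `p ^ s`. Each change of level costs
  -- at most `π`, and at level `r` only `H 0 = 0` is left.
  have key : ∀ s ≤ r, ‖∑ j ∈ range (p ^ r), H j * crossTerm A p a K j -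
      ∑ j ∈ range (p ^ r), H (p ^ s * (j / p ^ s)) * crossTerm A p a K j‖ ≤ π := by
    intro s
    induction s with
    | zero => intro _; simpa using h.pi_nonneg
    | succ s ih =>
      intro hs
      refine norm_sub_le_trans (ih (by omega)) ?_
      rw [← sum_sub_distrib, ← Nat.add_sub_cancel' (show s ≤ r by omega), pow_add,
        sum_range_mul_eq_sum_blocks]
      refine norm_sum_le_of_ultra h.pi_nonneg fun k _ => ?_
      have hpos : 0 < p ^ s := pow_pos h.p_pos _
      have : ∀ i ∈ range (p ^ s), H (p ^ s * ((i + p ^ s * k) / p ^ s)) *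
          crossTerm A p a K (i + p ^ s * k) - H (p ^ (s + 1) * ((i + p ^ s * k) / p ^ (s + 1))) *
          crossTerm A p a K (i + p ^ s * k) = (H (p ^ s * k) - H (p ^ (s + 1) * (k / p))) *
            crossTerm A p a K (i + p ^ s * k) := fun i hi => by
        have e1 : (i + p ^ s * k) / p ^ s = k := by
          rw [Nat.add_mul_div_left _ _ hpos, Nat.div_eq_of_lt (mem_range.1 hi), zero_add]
        rw [pow_succ, ← Nat.div_div_eq_div_mul, e1, sub_mul]
      rw [sum_congr rfl this, ← mul_sum, norm_mul]
      calc _ ≤ ‖H (p ^ s * k) - H (p ^ (s + 1) * (k / p))‖ * (π ^ (s + 1) * γ k) :=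
            mul_le_mul_of_nonneg_left (h.norm_blockSum_le ha s K k) (norm_nonneg _)
        _ = ‖H (p ^ s * k) - H (p ^ (s + 1) * (k / p))‖ * γ k * π ^ s * π := by ring
        _ ≤ π := mul_le_of_le_one_left h.pi_nonneg (hH s k)
  have hlast := key r le_rfl
  have hz : ∑ j ∈ range (p ^ r), H (p ^ r * (j / p ^ r)) * crossTerm A p a K j = 0 :=
    sum_eq_zero fun j hj => by rw [Nat.div_eq_of_lt (mem_range.1 hj), mul_zero, H0, zero_mul]
  rwa [hz, sub_zero, ← hext] at hlast

end DworkSystem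
end DworkCongruence

/-! ### Counting the exponents `l` with `{n / p ^ l} ≥ 1 / M`. -/

section LargeDigits

open Finset

/-- The exponents `l ≥ 1` for which the fractional part of `n / p ^ l` is at least `1 / M`. -/
def largeExponents (p M n : ℕ) : Finset ℕ :=
  (Icc 1 (M * n)).filter fun l => p ^ l ≤ M * (n % p ^ l)

variable {p M : ℕ}

theorem mem_largeExponents (hp : 1 < p) {n l : ℕ} :
    l ∈ largeExponents p M n ↔ 1 ≤ l ∧ p ^ l ≤ M * (n % p ^ l) := by
  simp only [largeExponents, mem_filter, mem_Icc]
  constructor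
  · rintro ⟨⟨h1, _⟩, h2⟩; exact ⟨h1, h2⟩
  -- The cut-off `M * n` loses nothing, since `l < p ^ l ≤ M * n`.
  · rintro ⟨h1, h2⟩
    exact ⟨⟨h1, (Nat.lt_pow_self hp).le.trans (h2.trans (Nat.mul_le_mul_left _ (Nat.mod_le _ _)))⟩,
      h2⟩

/-- All of `1, …, t` are exponents `l` at which the fractional part of `n / p ^ l` is at least
`1 / M`. -/
def AllLarge (p M n t : ℕ) : Prop :=
  ∀ l, 1 ≤ l → l ≤ t → p ^ l ≤ M * (n % p ^ l)

theorem mem_largeExponents_add (hp : 1 < p) {n t m l : ℕ} (hn : n < p ^ t)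
    (h : l ∈ largeExponents p M m) :
    t + l ∈ largeExponents p M (n + p ^ t * m) := by
  rw [mem_largeExponents hp] at h ⊢
  refine ⟨by omega, ?_⟩
  have hmod : p ^ t * (m % p ^ l) ≤ (n + p ^ t * m) % p ^ (t + l) := by
    rw [pow_add, Nat.mod_mul, Nat.add_mul_div_left _ _ (by positivity), Nat.div_eq_of_lt hn, zero_add]
    exact Nat.le_add_left _ _
  calc p ^ (t + l) = p ^ t * p ^ l := pow_add _ _ _
    _ ≤ p ^ t * (M * (m % p ^ l)) := Nat.mul_le_mul_left _ h.2
    _ = M * (p ^ t * (m % p ^ l)) := by ring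
    _ ≤ _ := Nat.mul_le_mul_left _ hmod

theorem card_largeExponents_add (hp : 1 < p) {n t m : ℕ} (hn : n < p ^ t) (h : AllLarge p M n t) :
    t + #(largeExponents p M m) ≤ #(largeExponents p M (n + p ^ t * m)) := by
  have hsub : Icc 1 t ∪ (largeExponents p M m).map (addLeftEmbedding t) ⊆
      largeExponents p M (n + p ^ t * m) := by
    intro l hl
    rw [mem_union, mem_Icc, mem_map] at hl
    rcases hl with hl | ⟨k, hk, rfl⟩
    · rw [mem_largeExponents hp]
      refine ⟨hl.1, ?_⟩
      have hmod : (n + p ^ t * m) % p ^ l = n % p ^ l := by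
        rw [← Nat.add_sub_cancel' hl.2, pow_add, mul_assoc, Nat.add_mul_mod_self_left]
      rw [hmod]
      exact h l hl.1 hl.2
    · exact mem_largeExponents_add hp hn hk
  have hdisj : Disjoint (Icc 1 t) ((largeExponents p M m).map (addLeftEmbedding t)) := by
    rw [disjoint_left]
    intro l hl hl'
    rw [mem_map] at hl'
    obtain ⟨k, hk, rfl⟩ := hl'
    rw [mem_largeExponents hp] at hk
    simp only [mem_Icc, addLeftEmbedding_apply] at hl
    omega
  have := card_le_card hsub
  rwa [card_union_of_disjoint hdisj, card_map, Nat.card_Icc, Nat.add_sub_cancel] at this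

/-- Reduce `u` modulo `p ^ (w - 1)` to `d`. The positive multiple `e p d + k` of `p ^ w` is at most
`e (v + p d)`, and `v + p d` is the residue of `v + p u`. -/
theorem le_mul_mod_of_dvd {e v u k w : ℕ} (he : e ≤ M) (hv : v < p) (hk : 1 ≤ k) (hk' : k ≤ e * v)
    (hw : 1 ≤ w) (hdvd : p ^ w ∣ e * (p * u) + k) : p ^ w ≤ M * ((v + p * u) % p ^ w) := by
  by_contra! hlt
  obtain ⟨w, rfl⟩ : ∃ w', w = w' + 1 := ⟨w - 1, by omega⟩
  obtain ⟨c, r, hj, hr0⟩ : ∃ c r, p ^ (w + 1) * c + r = v + p * u ∧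
      (v + p * u) % p ^ (w + 1) = r := ⟨_, _, Nat.div_add_mod _ _, rfl⟩
  rw [hr0] at hlt
  have hp : 0 < p := by omega
  have hc : p ^ w * c ≤ u := by
    have h1 : p * (p ^ w * c) < p * (u + 1) := by
      calc p * (p ^ w * c) = p ^ (w + 1) * c := by ring
        _ ≤ v + p * u := by omega
        _ < p * (u + 1) := by rw [mul_add]; omega
    exact Nat.lt_succ_iff.1 (Nat.lt_of_mul_lt_mul_left h1)
  obtain ⟨d, rfl⟩ := Nat.exists_eq_add_of_le hc
  have hr : r = v + p * d := by
    have : p ^ (w + 1) * c + r = v + p * (p ^ w * c + d) := hj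
    rw [mul_add, ← mul_assoc, ← pow_succ'] at this
    omega
  have h2 : p ^ (w + 1) ∣ e * (p * d) + k := by
    have : e * (p * (p ^ w * c + d)) + k = p ^ (w + 1) * (e * c) + (e * (p * d) + k) := by ring
    rw [this] at hdvd
    exact (Nat.dvd_add_right (Dvd.intro _ rfl)).1 hdvd
  have h3 := Nat.le_of_dvd (by omega) h2
  have h4 : e * r ≤ M * r := Nat.mul_le_mul_right _ he
  rw [hr, mul_add] at h4
  rw [hr] at hlt
  omega

theorem padicValNat_le_card_largeExponents [Fact p.Prime] {e v u k : ℕ} (he : e ≤ M) (hv : v < p)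
    (hk : 1 ≤ k) (hk' : k ≤ e * v) :
    padicValNat p (e * (p * u) + k) ≤ #(largeExponents p M (v + p * u)) := by
  have hp : 1 < p := (Fact.out : p.Prime).one_lt
  have hsub : Icc 1 (padicValNat p (e * (p * u) + k)) ⊆ largeExponents p M (v + p * u) := by
    intro l hl
    rw [mem_Icc] at hl
    rw [mem_largeExponents hp]
    exact ⟨hl.1, le_mul_mod_of_dvd he hv hk hk' hl.1
      ((pow_dvd_pow _ hl.2).trans pow_padicValNat_dvd)⟩
  simpa using card_le_card hsub

/-- If the valuation exceeds `s`, then `p ^ s` divides `k` and can be divided out, which leaves the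
case `s = 0`. -/
theorem padicValNat_le_add_card_largeExponents [Fact p.Prime] {e v u k s : ℕ} (he : e ≤ M)
    (hv : v < p) (hk : 1 ≤ k) (hk' : k ≤ e * (p ^ s * v)) :
    padicValNat p (e * (p ^ (s + 1) * u) + k) ≤ s + #(largeExponents p M (v + p * u)) := by
  have hp0 : 0 < p := by omega
  set n := e * (p ^ (s + 1) * u) + k with hn
  rcases le_or_gt (padicValNat p n) s with h | h
  · omega
  have h1 : p ^ s ∣ n := (pow_dvd_pow _ h.le).trans pow_padicValNat_dvd
  have h2 : p ^ s ∣ k := (Nat.dvd_add_right (by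
    rw [pow_succ]; exact ⟨e * (p * u), by ring⟩)).1 (hn ▸ h1)
  obtain ⟨k, rfl⟩ := h2
  have hps : 0 < p ^ s := by positivity
  have hn' : n = p ^ s * (e * (p * u) + k) := by rw [hn]; ring
  have hk1 : 1 ≤ k := Nat.one_le_iff_ne_zero.2 fun h => by simp [h] at hk
  have hk2 : k ≤ e * v := by
    refine Nat.le_of_mul_le_mul_left ?_ hps
    linarith [show p ^ s * (e * v) = e * (p ^ s * v) by ring]
  rw [hn', padicValNat.mul (by positivity) (by omega), padicValNat.prime_pow]
  exact Nat.add_le_add_left (padicValNat_le_card_largeExponents he hv hk1 hk2) _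

/-- The prefix of `u` ending at its top nonzero digit is less than `p` and not bad. This forces `M <
p ^ t`, where `t` counts the places of the block from that digit upwards. -/
theorem exists_lt_of_goodDigits (hp : 1 < p) {s u : ℕ} (hu : u < p ^ s)
    (hg : GoodDigits p (AllLarge p M) s u) (hu0 : 0 < u) :
    ∃ t ≤ s, u < p ^ (s + 1 - t) ∧ M < p ^ t := by
  induction s generalizing u with
  | zero => simp at hu; omega
  | succ s ih =>
    have hp0 : 0 < p := by omega
    rcases Nat.eq_zero_or_pos (u / p) with h | h
    · have hup : u < p := by
        rcases Nat.div_eq_zero_iff.1 h with h | h <;> omega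
      have := hg.2
      simp only [AllLarge, not_forall, not_le] at this
      obtain ⟨l, hl1, hl2, hl⟩ := this
      rw [Nat.mod_eq_of_lt (hup.trans_le (Nat.le_self_pow (by omega) p))] at hl
      refine ⟨s + 1, le_rfl, by simpa using hup, ?_⟩
      calc M ≤ M * u := Nat.le_mul_of_pos_right _ hu0
        _ < p ^ l := hl
        _ ≤ _ := Nat.pow_le_pow_right hp0 hl2
    · obtain ⟨t, ht, h1, h2⟩ := ih (Nat.div_lt_of_lt_mul (by rwa [← pow_succ'])) hg.1 h
      refine ⟨t, by omega, ?_, h2⟩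
      rw [show s + 1 + 1 - t = s + 1 - t + 1 by omega, pow_succ]
      exact (Nat.div_lt_iff_lt_mul hp0).1 h1

theorem mul_lt_of_goodDigits (hp : 1 < p) {s u : ℕ} (hu : u < p ^ s)
    (hg : GoodDigits p (AllLarge p M) s u) : M * u < p ^ (s + 1) := by
  rcases Nat.eq_zero_or_pos u with rfl | h0
  · simpa using pow_pos (by omega) _
  obtain ⟨t, ht, h1, h2⟩ := exists_lt_of_goodDigits hp hu hg h0
  calc M * u < p ^ t * p ^ (s + 1 - t) := Nat.mul_lt_mul'' h2 h1
    _ = _ := by rw [← pow_add]; congr 1; omega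

/-- Goodness rules out one exponent among `1, …, s + 1`, and `M u < p ^ (s + 2)` rules out all
larger ones. -/
theorem card_largeExponents_le_of_goodDigits (hp : 1 < p) {s u : ℕ} (hu : u < p ^ (s + 1))
    (hg : GoodDigits p (AllLarge p M) (s + 1) u) : #(largeExponents p M u) ≤ s := by
  have h1 := hg.2
  simp only [AllLarge, not_forall, not_le] at h1
  obtain ⟨l, hl1, hl2, hl⟩ := h1
  have hsub : largeExponents p M u ⊆ (Icc 1 (s + 1)).erase l := by
    intro k hk
    rw [mem_largeExponents hp] at hk
    rw [mem_erase, mem_Icc]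
    refine ⟨fun h => ?_, hk.1, ?_⟩
    · subst h; omega
    · by_contra! hks
      have h2 := mul_lt_of_goodDigits hp hu hg
      have h3 : p ^ (s + 1 + 1) ≤ p ^ k := Nat.pow_le_pow_right (by omega) hks
      have h4 := Nat.mul_le_mul_left M (Nat.mod_le u (p ^ k))
      omega
  have := card_le_card hsub
  rw [card_erase_of_mem (mem_Icc.2 ⟨hl1, hl2⟩)] at this
  simpa using this

end LargeDigits

/-! ### Norms of natural numbers in `ℚ_[p]`. -/

section PadicNorm
variable {p : ℕ} [Fact p.Prime]

theorem norm_natCast_eq_inv_pow {n : ℕ} (hn : n ≠ 0) :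
    ‖(n : ℚ_[p])‖ = (p : ℝ)⁻¹ ^ padicValNat p n := by
  rw [Padic.norm_eq_zpow_neg_valuation (by exact_mod_cast hn), Padic.valuation_natCast, zpow_neg,
    zpow_natCast, inv_pow]

theorem inv_pow_le_norm_natCast {n k : ℕ} (hn : n ≠ 0) (h : padicValNat p n ≤ k) :
    (p : ℝ)⁻¹ ^ k ≤ ‖(n : ℚ_[p])‖ := by
  rw [norm_natCast_eq_inv_pow hn]
  exact pow_le_pow_of_le_one (by positivity)
    (inv_le_one_of_one_le₀ (by exact_mod_cast (Fact.out : p.Prime).one_lt.le)) h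

end PadicNorm

/-! ### The Landau function and the `p`-adic norm of `Q(n)`. -/

section Landau

open Finset

variable {q₁ q₂ : ℕ} {e : Fin q₁ → ℕ} {f : Fin q₂ → ℕ}

/-- The value of the Landau function at `n / d`, computed with natural number division. -/
def landauNat {q₁ q₂ : ℕ} (e : Fin q₁ → ℕ) (f : Fin q₂ → ℕ) (n d : ℕ) : ℤ :=
  ∑ i, ((e i * n / d : ℕ) : ℤ) - ∑ j, ((f j * n / d : ℕ) : ℤ)

theorem le_maxTerm_left (e : Fin q₁ → ℕ) (f : Fin q₂ → ℕ) (i : Fin q₁) : e i ≤ maxTerm e f :=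
  (le_sup (mem_univ i)).trans (le_max_left _ _)

theorem le_maxTerm_right (e : Fin q₁ → ℕ) (f : Fin q₂ → ℕ) (j : Fin q₂) : f j ≤ maxTerm e f :=
  (le_sup (mem_univ j)).trans (le_max_right _ _)

theorem floor_natCast_mul_div (a n d : ℕ) :
    ⌊(a : ℝ) * ((n : ℝ) / d)⌋ = ((a * n / d : ℕ) : ℤ) := by
  rw [← mul_div_assoc, ← Nat.cast_mul, ← Nat.floor_div_eq_div (K := ℝ), Int.natCast_floor_eq_floor (by positivity)]

theorem landauDelta_div (e : Fin q₁ → ℕ) (f : Fin q₂ → ℕ) (n d : ℕ) :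
    landauDelta e f ((n : ℝ) / d) = landauNat e f n d := by
  simp only [landauDelta, landauNat, floor_natCast_mul_div]

theorem landauNat_add_mul (hsum : ∑ i, e i = ∑ j, f j) {d : ℕ} (hd : 0 < d) (n m : ℕ) :
    landauNat e f (n + d * m) d = landauNat e f n d := by
  have h : ∀ a : ℕ, ((a * (n + d * m) / d : ℕ) : ℤ) = ((a * n / d : ℕ) : ℤ) + a * m := fun a => by
    rw [show a * (n + d * m) = a * n + d * (a * m) by ring, Nat.add_mul_div_left _ _ hd]
    push_cast; ring
  have hs : (∑ i, (e i : ℤ)) = ∑ j, (f j : ℤ) := by exact_mod_cast hsum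
  simp only [landauNat, h, sum_add_distrib, ← sum_mul, hs]
  ring

theorem landauNat_mod (hsum : ∑ i, e i = ∑ j, f j) {d : ℕ} (hd : 0 < d) (n : ℕ) :
    landauNat e f (n % d) d = landauNat e f n d := by
  conv_rhs => rw [← Nat.mod_add_div n d]
  rw [landauNat_add_mul hsum hd]

theorem landauNat_eq_zero {n d : ℕ} (h : maxTerm e f * n < d) : landauNat e f n d = 0 := by
  have h1 : ∀ i, e i * n / d = 0 := fun i =>
    Nat.div_eq_of_lt ((Nat.mul_le_mul_right _ (le_maxTerm_left e f i)).trans_lt h)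
  have h2 : ∀ j, f j * n / d = 0 := fun j =>
    Nat.div_eq_of_lt ((Nat.mul_le_mul_right _ (le_maxTerm_right e f j)).trans_lt h)
  simp [landauNat, h1, h2]

theorem landauNat_nonneg (hsum : ∑ i, e i = ∑ j, f j)
    (h0 : ∀ x ∈ Set.Icc (0 : ℝ) 1, 0 ≤ landauDelta e f x) {d : ℕ} (hd : 0 < d) (n : ℕ) :
    0 ≤ landauNat e f n d := by
  rw [← landauNat_mod hsum hd, ← landauDelta_div]
  have hd' : (0 : ℝ) < d := by exact_mod_cast hd
  refine h0 _ ⟨by positivity, ?_⟩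
  rw [div_le_one hd']
  exact_mod_cast (Nat.mod_lt _ hd).le

theorem one_le_landauNat (hsum : ∑ i, e i = ∑ j, f j)
    (h1 : ∀ x ∈ Set.Ico (1 / (maxTerm e f : ℝ)) 1, 1 ≤ landauDelta e f x) {n d : ℕ} (hd : 0 < d)
    (h : d ≤ maxTerm e f * (n % d)) : 1 ≤ landauNat e f n d := by
  rw [← landauNat_mod hsum hd, ← landauDelta_div]
  have hd' : (0 : ℝ) < d := by exact_mod_cast hd
  have hM : (0 : ℝ) < maxTerm e f := by
    have : maxTerm e f ≠ 0 := fun h0 => by rw [h0] at h; omega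
    exact_mod_cast Nat.pos_of_ne_zero this
  refine h1 _ ⟨?_, ?_⟩
  · rw [div_le_div_iff₀ hM hd', one_mul, mul_comm]
    exact_mod_cast h
  · rw [div_lt_one hd']
    exact_mod_cast Nat.mod_lt _ hd

theorem factorialRatio_zero : factorialRatio e f 0 = 1 := by simp [factorialRatio]

theorem factorialRatio_pos (n : ℕ) : 0 < factorialRatio e f n :=
  div_pos (prod_pos fun _ _ => by positivity) (prod_pos fun _ _ => by positivity)

variable (p : ℕ) [Fact p.Prime]

theorem norm_factorial_padic {N b : ℕ} (hb : N < p ^ b) :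
    ‖((Nat.factorial N : ℕ) : ℚ_[p])‖ = (p : ℝ)⁻¹ ^ (∑ l ∈ Icc 1 b, N / p ^ l) := by
  rw [norm_natCast_eq_inv_pow (Nat.factorial_ne_zero _), padicValNat_factorial (b := b + 1)]
  · rfl
  · rcases Nat.eq_zero_or_pos N with rfl | hN
    · simp
    · exact Nat.lt_succ_of_lt (Nat.log_lt_of_lt_pow hN.ne' hb)

theorem norm_factorialRatio {n b : ℕ} (hb : maxTerm e f * n < p ^ b) :
    ‖(factorialRatio e f n : ℚ_[p])‖ = (p : ℝ)⁻¹ ^ (∑ l ∈ Icc 1 b, landauNat e f n (p ^ l)) := by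
  have hp : (p : ℝ)⁻¹ ≠ 0 := by simp [(Fact.out : p.Prime).ne_zero]
  have h1 : ∀ i, ‖((Nat.factorial (e i * n) : ℕ) : ℚ_[p])‖ =
      (p : ℝ)⁻¹ ^ (∑ l ∈ Icc 1 b, e i * n / p ^ l) := fun i =>
    norm_factorial_padic p ((Nat.mul_le_mul_right _ (le_maxTerm_left e f i)).trans_lt hb)
  have h2 : ∀ j, ‖((Nat.factorial (f j * n) : ℕ) : ℚ_[p])‖ =
      (p : ℝ)⁻¹ ^ (∑ l ∈ Icc 1 b, f j * n / p ^ l) := fun j =>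
    norm_factorial_padic p ((Nat.mul_le_mul_right _ (le_maxTerm_right e f j)).trans_lt hb)
  rw [factorialRatio]
  push_cast
  rw [norm_div, norm_prod, norm_prod, prod_congr rfl fun i _ => h1 i, prod_congr rfl fun j _ => h2 j,
    prod_pow_eq_pow_sum, prod_pow_eq_pow_sum, ← zpow_natCast, ← zpow_natCast, ← zpow_sub₀ hp]
  congr 1
  push_cast
  simp only [landauNat, sum_sub_distrib]
  rw [sum_comm, sum_comm (s := Icc 1 b) (t := univ) (f := fun l j => ((f j * n / p ^ l : ℕ) : ℤ))]
  simp

/-- In Legendre's formula the terms with `l ≤ s` cancel by periodicity, and for `l > s` those of `n`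
vanish. Each large exponent `k` of `m` makes `s + k` large for `n + p ^ s m`, where `Δ ≥ 1`. -/
theorem norm_factorialRatio_add_div_le (hsum : ∑ i, e i = ∑ j, f j)
    (h0 : ∀ x ∈ Set.Icc (0 : ℝ) 1, 0 ≤ landauDelta e f x)
    (h1 : ∀ x ∈ Set.Ico (1 / (maxTerm e f : ℝ)) 1, 1 ≤ landauDelta e f x) {n s : ℕ} (m : ℕ)
    (hn : n < p ^ s) (hMn : maxTerm e f * n < p ^ (s + 1)) :
    ‖(factorialRatio e f (n + p ^ s * m) / factorialRatio e f n : ℚ_[p])‖ ≤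
      (p : ℝ)⁻¹ ^ #(largeExponents p (maxTerm e f) m) := by
  have hp : 1 < p := (Fact.out : p.Prime).one_lt
  have hp0 : (p : ℝ)⁻¹ ≠ 0 := by simp [(Fact.out : p.Prime).ne_zero]
  set M := maxTerm e f
  obtain ⟨b, hb⟩ : ∃ b, M * (n + p ^ s * m) < p ^ b := ⟨_, Nat.lt_pow_self hp⟩
  have hb' : M * n < p ^ b := (Nat.mul_le_mul_left _ (Nat.le_add_right _ _)).trans_lt hb
  rw [norm_div, norm_factorialRatio p hb, norm_factorialRatio p hb', ← zpow_sub₀ hp0,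
    ← sum_sub_distrib, ← zpow_natCast]
  refine zpow_le_zpow_right_of_le_one₀ (by positivity)
    (inv_le_one_of_one_le₀ (by exact_mod_cast hp.le)) ?_
  have hsub : (largeExponents p M m).map (addLeftEmbedding s) ⊆ Icc 1 b := by
    intro l hl
    obtain ⟨k, hk, rfl⟩ := mem_map.1 hl
    have hk' := (mem_largeExponents hp).1 (mem_largeExponents_add hp hn hk)
    simp only [mem_Icc, addLeftEmbedding_apply]
    refine ⟨hk'.1, ?_⟩
    by_contra! hlt
    have h2 := Nat.pow_le_pow_right hp.le hlt.le
    have h3 := Nat.mul_le_mul_left M (Nat.mod_le (n + p ^ s * m) (p ^ (s + k)))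
    omega
  calc ((#(largeExponents p M m) : ℕ) : ℤ)
      = ∑ l ∈ (largeExponents p M m).map (addLeftEmbedding s), (1 : ℤ) := by simp
    _ ≤ ∑ l ∈ (largeExponents p M m).map (addLeftEmbedding s),
        (landauNat e f (n + p ^ s * m) (p ^ l) - landauNat e f n (p ^ l)) := by
      refine sum_le_sum fun l hl => ?_
      obtain ⟨k, hk, rfl⟩ := mem_map.1 hl
      have hk' := (mem_largeExponents hp).1 (mem_largeExponents_add hp hn hk)
      have hk1 := ((mem_largeExponents hp).1 hk).1
      simp only [addLeftEmbedding_apply]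
      rw [landauNat_eq_zero (n := n) (hMn.trans_le (Nat.pow_le_pow_right hp.le (by omega))),
        sub_zero]
      exact one_le_landauNat hsum h1 (by positivity) hk'.2
    _ ≤ _ := by
      refine sum_le_sum_of_subset_of_nonneg hsub fun l _ _ => ?_
      rcases le_or_gt l s with hl | hl
      · rw [← Nat.add_sub_cancel' hl, pow_add, mul_assoc,
          landauNat_add_mul hsum (by positivity), sub_self]
      · rw [landauNat_eq_zero (n := n) (hMn.trans_le (Nat.pow_le_pow_right hp.le (by omega))),
          sub_zero]
        exact landauNat_nonneg hsum h0 (by positivity) _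

theorem norm_factorialRatio_le (hsum : ∑ i, e i = ∑ j, f j)
    (h0 : ∀ x ∈ Set.Icc (0 : ℝ) 1, 0 ≤ landauDelta e f x)
    (h1 : ∀ x ∈ Set.Ico (1 / (maxTerm e f : ℝ)) 1, 1 ≤ landauDelta e f x) (n : ℕ) :
    ‖(factorialRatio e f n : ℚ_[p])‖ ≤ (p : ℝ)⁻¹ ^ #(largeExponents p (maxTerm e f) n) := by
  have := norm_factorialRatio_add_div_le p hsum h0 h1 (n := 0) (s := 0) n (by simp)
    (by simpa using (Fact.out : p.Prime).pos)
  simpa [factorialRatio_zero] using this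

theorem norm_factorialRatio_le_one (hsum : ∑ i, e i = ∑ j, f j)
    (h0 : ∀ x ∈ Set.Icc (0 : ℝ) 1, 0 ≤ landauDelta e f x) (n : ℕ) :
    ‖(factorialRatio e f n : ℚ_[p])‖ ≤ 1 := by
  have hp : 1 < p := (Fact.out : p.Prime).one_lt
  rw [norm_factorialRatio p (b := maxTerm e f * n) (Nat.lt_pow_self hp)]
  refine (zpow_le_zpow_right_of_le_one₀ (by positivity)
    (inv_le_one_of_one_le₀ (by exact_mod_cast hp.le)) (sum_nonneg fun l _ =>
      landauNat_nonneg hsum h0 (d := p ^ l) (by positivity) n)).trans (zpow_zero _).le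

end Landau

/-! ### Factorials modulo powers of `p`. -/

section FactorialCongruence

open Finset

/-- The product of the integers up to `p * N` that are prime to `p`. -/
def unitFactorial (p N : ℕ) : ℕ :=
  ∏ k ∈ range N, ∏ r ∈ range (p - 1), (p * k + (r + 1))

theorem factorial_add_eq_mul_prod (a c : ℕ) :
    (a + c).factorial = a.factorial * ∏ r ∈ range c, (a + (r + 1)) := by
  induction c with
  | zero => simp
  | succ c ih => rw [prod_range_succ, ← mul_assoc, ← ih, ← add_assoc, Nat.factorial_succ, mul_comm]

theorem factorial_mul_eq {p : ℕ} (hp : 0 < p) (N : ℕ) :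
    (p * N).factorial = p ^ N * N.factorial * unitFactorial p N := by
  induction N with
  | zero => simp [unitFactorial]
  | succ N ih =>
    obtain ⟨q, rfl⟩ : ∃ q, p = q + 1 := ⟨p - 1, by omega⟩
    rw [Nat.mul_succ, factorial_add_eq_mul_prod, ih, prod_range_succ, Nat.factorial_succ, unitFactorial, unitFactorial,
      prod_range_succ, Nat.add_sub_cancel]
    ring

/-- Modulo `p ^ (s + 1)` the factors prime to `p` repeat after `p ^ s` values of `k`. The residue of
`unitFactorial p (p ^ s)` is never computed: its powers cancel in `Q` since `∑ eᵢ = ∑ fⱼ`. -/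
theorem unitFactorial_add_mul (p N c s : ℕ) :
    (unitFactorial p (N + p ^ s * c) : ZMod (p ^ (s + 1))) =
      unitFactorial p N * (unitFactorial p (p ^ s)) ^ c := by
  have hone : ∀ N, (unitFactorial p (p ^ s + N) : ZMod (p ^ (s + 1))) =
      unitFactorial p (p ^ s) * unitFactorial p N := by
    intro N
    simp only [unitFactorial]
    rw [prod_range_add, Nat.cast_mul]
    congr 1
    push_cast
    refine prod_congr rfl fun k _ => prod_congr rfl fun r _ => ?_
    have : ((p : ZMod (p ^ (s + 1))) * p ^ s) = 0 := by
      have := ZMod.natCast_self (p ^ (s + 1))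
      rw [pow_succ'] at this ⊢
      exact_mod_cast this
    rw [mul_add, this, zero_add]
  induction c with
  | zero => simp
  | succ c ih =>
    rw [show N + p ^ s * (c + 1) = p ^ s + (N + p ^ s * c) by ring, hone, ih]
    ring

variable {p : ℕ} [Fact p.Prime]

theorem norm_unitFactorial (N : ℕ) : ‖(unitFactorial p N : ℚ_[p])‖ = 1 := by
  rw [unitFactorial]
  push_cast
  rw [norm_prod]
  refine prod_eq_one fun k _ => ?_
  rw [norm_prod]
  refine prod_eq_one fun r hr => ?_
  have hr := mem_range.1 hr
  have : ‖((p * k + (r + 1) : ℕ) : ℚ_[p])‖ = 1 := by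
    rw [Padic.norm_natCast_eq_one_iff, (Fact.out : p.Prime).coprime_iff_not_dvd,
      Nat.dvd_add_right (Dvd.intro _ rfl)]
    exact fun h => by have := Nat.le_of_dvd (by omega) h; omega
  exact_mod_cast this

theorem norm_natCast_sub_natCast_le {a b k : ℕ} (h : (a : ZMod (p ^ k)) = b) :
    ‖((a : ℚ_[p]) - b)‖ ≤ (p : ℝ)⁻¹ ^ k := by
  have : ((p ^ k : ℕ) : ℤ) ∣ (a : ℤ) - b := by
    rw [← ZMod.intCast_zmod_eq_zero_iff_dvd]; push_cast; rw [h, sub_self]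
  have h2 := (Padic.norm_int_le_pow_iff_dvd (p := p) ((a : ℤ) - b) k).2 (by exact_mod_cast this)
  push_cast at h2
  rwa [zpow_neg, zpow_natCast, ← inv_pow] at h2

theorem norm_unitFactorial_div_sub_one_le (N c s : ℕ) :
    ‖(unitFactorial p (N + p ^ s * c) / (unitFactorial p N * unitFactorial p (p ^ s) ^ c) - 1 :
      ℚ_[p])‖ ≤ (p : ℝ)⁻¹ ^ (s + 1) := by
  have h := norm_natCast_sub_natCast_le (p := p) (k := s + 1)
    (a := unitFactorial p (N + p ^ s * c)) (b := unitFactorial p N * unitFactorial p (p ^ s) ^ c)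
    (by push_cast; exact unitFactorial_add_mul p N c s)
  push_cast at h
  have hn : ‖(unitFactorial p N * unitFactorial p (p ^ s) ^ c : ℚ_[p])‖ = 1 := by
    simp [norm_unitFactorial]
  have hne : (unitFactorial p N * unitFactorial p (p ^ s) ^ c : ℚ_[p]) ≠ 0 := by
    rw [← norm_pos_iff, hn]; norm_num
  rw [div_sub_one hne, norm_div, hn, div_one]
  exact h

end FactorialCongruence

/-! ### Products and quotients of elements close to `1`. -/

section CloseToOne

open Finset

variable {𝕜 : Type*} [NormedField 𝕜] [IsUltrametricDist 𝕜] {c : ℝ}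

theorem norm_eq_one_of_norm_sub_one_lt {x : 𝕜} (h : ‖x - 1‖ < 1) : ‖x‖ = 1 := by
  have := IsUltrametricDist.norm_add_eq_max_of_norm_ne_norm (x := x - 1) (y := (1 : 𝕜))
    (by rw [norm_one]; exact h.ne)
  rwa [sub_add_cancel, norm_one, max_eq_right h.le] at this

theorem norm_mul_sub_one_le {x y : 𝕜} (hc : c < 1) (hx : ‖x - 1‖ ≤ c) (hy : ‖y - 1‖ ≤ c) :
    ‖x * y - 1‖ ≤ c := by
  refine norm_sub_le_trans (y := y) ?_ hy
  rwa [show x * y - y = (x - 1) * y by ring, norm_mul,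
    norm_eq_one_of_norm_sub_one_lt (hy.trans_lt hc), mul_one]

theorem norm_div_sub_one_le {x y : 𝕜} (hc : c < 1) (hx : ‖x - 1‖ ≤ c) (hy : ‖y - 1‖ ≤ c) :
    ‖x / y - 1‖ ≤ c := by
  have hn := norm_eq_one_of_norm_sub_one_lt (hy.trans_lt hc)
  have hne : y ≠ 0 := by rw [← norm_pos_iff, hn]; exact one_pos
  rw [div_sub_one hne, norm_div, hn, div_one]
  refine norm_sub_le_trans hx ?_
  rwa [norm_sub_rev]

theorem norm_prod_sub_one_le {ι : Type*} {t : Finset ι} {g : ι → 𝕜} (hc0 : 0 ≤ c) (hc : c < 1)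
    (h : ∀ i ∈ t, ‖g i - 1‖ ≤ c) : ‖∏ i ∈ t, g i - 1‖ ≤ c := by
  classical
  induction t using Finset.induction_on with
  | empty => simpa using hc0
  | insert a t ha ih =>
    rw [prod_insert ha]
    exact norm_mul_sub_one_le hc (h _ (mem_insert_self _ _))
      (ih fun i hi => h i (mem_insert_of_mem hi))

end CloseToOne

/-! ### The factorial ratios satisfy Dwork's hypotheses. -/

section FactorialRatioDwork

open Finset

variable {q₁ q₂ : ℕ} {e : Fin q₁ → ℕ} {f : Fin q₂ → ℕ}

/-- The quotient of `(a (v + p n))!` by `p ^ (a n) (a n)!`. -/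
def factorialStep (p v a n : ℕ) : ℕ :=
  unitFactorial p (a * n) * ∏ k ∈ range (a * v), (a * (p * n) + (k + 1))

theorem factorial_eq_factorialStep {p : ℕ} (hp : 0 < p) (v a n : ℕ) :
    (a * (v + p * n)).factorial = p ^ (a * n) * (a * n).factorial * factorialStep p v a n := by
  rw [show a * (v + p * n) = a * (p * n) + a * v by ring, factorial_add_eq_mul_prod,
    show a * (p * n) = p * (a * n) by ring, factorial_mul_eq hp, factorialStep,
    show a * (p * n) = p * (a * n) by ring]
  ring

theorem factorialStep_ne_zero {p : ℕ} (hp : 0 < p) (v a n : ℕ) : factorialStep p v a n ≠ 0 :=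
  fun h => (a * (v + p * n)).factorial_ne_zero (by rw [factorial_eq_factorialStep hp, h, mul_zero])

theorem factorialRatio_add_mul (hsum : ∑ i, e i = ∑ j, f j) {p : ℕ} (hp : 0 < p) (v n : ℕ) :
    factorialRatio e f (v + p * n) = factorialRatio e f n *
      ((∏ i, (factorialStep p v (e i) n : ℚ)) / ∏ j, (factorialStep p v (f j) n : ℚ)) := by
  simp only [factorialRatio, factorial_eq_factorialStep hp]
  push_cast
  simp only [prod_mul_distrib, prod_pow_eq_pow_sum, ← sum_mul, hsum]
  have hp' : (p : ℚ) ≠ 0 := by exact_mod_cast hp.ne'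
  rw [mul_assoc, mul_assoc, mul_div_mul_left _ _ (pow_ne_zero _ hp'), mul_div_mul_comm]

variable {p : ℕ} [Fact p.Prime]

/-- The part prime to `p` is accurate to precision `s + 1`. Every other factor moves by a multiple
of `p ^ (s + 1)`, and its own valuation is at most the number of large exponents, which is therefore
the only precision lost. -/
theorem norm_factorialStep_div_sub_one_le {M a v u s m : ℕ} (ha : a ≤ M) (hv : v < p)
    (hs : #(largeExponents p M (v + p * u)) ≤ s) :
    ‖(factorialStep p v a (u + p ^ s * m) : ℚ_[p]) / (factorialStep p v a u *
      (unitFactorial p (p ^ s) : ℚ_[p]) ^ (a * m)) - 1‖ ≤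
      (p : ℝ)⁻¹ ^ (s + 1 - #(largeExponents p M (v + p * u))) := by
  have hp := (Fact.out : p.Prime)
  set ν := #(largeExponents p M (v + p * u))
  have hpi : (p : ℝ)⁻¹ < 1 := inv_lt_one_of_one_lt₀ (by exact_mod_cast hp.one_lt)
  have hpi0 : 0 < (p : ℝ)⁻¹ := inv_pos.2 (by exact_mod_cast hp.pos)
  have hc : (p : ℝ)⁻¹ ^ (s + 1 - ν) < 1 := pow_lt_one₀ hpi0.le hpi (by omega)
  have hsplit : (factorialStep p v a (u + p ^ s * m) : ℚ_[p]) / (factorialStep p v a u *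
      (unitFactorial p (p ^ s) : ℚ_[p]) ^ (a * m)) =
      (unitFactorial p (a * u + p ^ s * (a * m)) /
        (unitFactorial p (a * u) * unitFactorial p (p ^ s) ^ (a * m))) *
      ∏ k ∈ range (a * v), (((a * (p * (u + p ^ s * m)) + (k + 1) : ℕ) : ℚ_[p]) /
        ((a * (p * u) + (k + 1) : ℕ) : ℚ_[p])) := by
    rw [prod_div_distrib, div_mul_div_comm, factorialStep, factorialStep,
      show a * (u + p ^ s * m) = a * u + p ^ s * (a * m) by ring]
    push_cast
    congr 1
    ring
  rw [hsplit]
  refine norm_mul_sub_one_le hc ((norm_unitFactorial_div_sub_one_le _ _ _).trans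
    (pow_le_pow_of_le_one hpi0.le hpi.le (by omega))) ?_
  refine norm_prod_sub_one_le (pow_nonneg hpi0.le _) hc fun k hk => ?_
  have hk' := mem_range.1 hk
  have hle := inv_pow_le_norm_natCast (p := p) (n := a * (p * u) + (k + 1)) (by omega)
    (padicValNat_le_card_largeExponents (k := k + 1) (u := u) ha hv (by omega) (by omega))
  have hne : ((a * (p * u) + (k + 1) : ℕ) : ℚ_[p]) ≠ 0 := by
    have : a * (p * u) + (k + 1) ≠ 0 := by omega
    exact_mod_cast this
  rw [div_sub_one hne, norm_div, div_le_iff₀ (norm_pos_iff.2 hne)]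
  have hnum : ((a * (p * (u + p ^ s * m)) + (k + 1) : ℕ) : ℚ_[p]) -
      ((a * (p * u) + (k + 1) : ℕ) : ℚ_[p]) = ((a * m : ℕ) : ℚ_[p]) * (p : ℚ_[p]) ^ (s + 1) := by
    push_cast; ring
  rw [hnum, norm_mul, Padic.norm_p_pow, zpow_neg, zpow_natCast, ← inv_pow]
  calc _ ≤ 1 * (p : ℝ)⁻¹ ^ (s + 1) :=
        mul_le_mul_of_nonneg_right (by exact_mod_cast Padic.norm_int_le_one (p := p) (a * m : ℕ))
          (pow_nonneg hpi0.le _)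
    _ = (p : ℝ)⁻¹ ^ (s + 1 - ν) * (p : ℝ)⁻¹ ^ ν := by
      rw [one_mul, ← pow_add]; congr 1; omega
    _ ≤ _ := mul_le_mul_of_nonneg_left hle (pow_nonneg hpi0.le _)

theorem norm_factorialRatio_ratio_sub_one_le (hsum : ∑ i, e i = ∑ j, f j) {v u s m : ℕ}
    (hv : v < p) (hs : #(largeExponents p (maxTerm e f) (v + p * u)) ≤ s) :
    ‖((factorialRatio e f (v + p * (u + p ^ s * m)) / factorialRatio e f (u + p ^ s * m)) /
      (factorialRatio e f (v + p * u) / factorialRatio e f u) : ℚ_[p]) - 1‖ ≤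
      (p : ℝ)⁻¹ ^ (s + 1 - #(largeExponents p (maxTerm e f) (v + p * u))) := by
  have hp := (Fact.out : p.Prime)
  have hpi : (p : ℝ)⁻¹ < 1 := inv_lt_one_of_one_lt₀ (by exact_mod_cast hp.one_lt)
  have hpi0 : 0 < (p : ℝ)⁻¹ := inv_pos.2 (by exact_mod_cast hp.pos)
  have hc : (p : ℝ)⁻¹ ^ (s + 1 - #(largeExponents p (maxTerm e f) (v + p * u))) < 1 :=
    pow_lt_one₀ hpi0.le hpi (by omega)
  have hQ : ∀ n, (factorialRatio e f n : ℚ_[p]) ≠ 0 := fun n => by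
    exact_mod_cast (factorialRatio_pos n).ne'
  have hstep : ∀ n, (factorialRatio e f (v + p * n) / factorialRatio e f n : ℚ_[p]) =
      (∏ i, (factorialStep p v (e i) n : ℚ_[p])) / ∏ j, (factorialStep p v (f j) n : ℚ_[p]) := by
    intro n
    rw [factorialRatio_add_mul hsum hp.pos, Rat.cast_mul, mul_div_cancel_left₀ _ (hQ n)]
    push_cast; rfl
  have hw : (unitFactorial p (p ^ s) : ℚ_[p]) ≠ 0 := by
    rw [← norm_pos_iff, norm_unitFactorial]; exact one_pos
  have hT : ∀ a n, (factorialStep p v a n : ℚ_[p]) ≠ 0 := fun a n => by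
    exact_mod_cast factorialStep_ne_zero hp.pos v a n
  have hprod : ((factorialRatio e f (v + p * (u + p ^ s * m)) / factorialRatio e f (u + p ^ s * m)) /
      (factorialRatio e f (v + p * u) / factorialRatio e f u) : ℚ_[p]) =
      (∏ i, (factorialStep p v (e i) (u + p ^ s * m) : ℚ_[p]) / (factorialStep p v (e i) u *
        (unitFactorial p (p ^ s) : ℚ_[p]) ^ (e i * m))) /
      ∏ j, (factorialStep p v (f j) (u + p ^ s * m) : ℚ_[p]) / (factorialStep p v (f j) u *
        (unitFactorial p (p ^ s) : ℚ_[p]) ^ (f j * m)) := by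
    rw [hstep, hstep]
    simp only [prod_div_distrib, prod_mul_distrib, prod_pow_eq_pow_sum, ← sum_mul, hsum]
    have h1 := fun n => prod_ne_zero_iff.2 fun i (_ : i ∈ univ) => hT (e i) n
    have h2 := fun n => prod_ne_zero_iff.2 fun j (_ : j ∈ univ) => hT (f j) n
    have h1' := h1 u
    have h2' := h2 u
    have h2'' := h2 (u + p ^ s * m)
    have h3 := pow_ne_zero ((∑ j, f j) * m) hw
    field_simp
  rw [hprod]
  exact norm_div_sub_one_le hc
    (norm_prod_sub_one_le (pow_nonneg hpi0.le _) hc fun i _ =>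
      norm_factorialStep_div_sub_one_le (le_maxTerm_left e f i) hv hs)
    (norm_prod_sub_one_le (pow_nonneg hpi0.le _) hc fun j _ =>
      norm_factorialStep_div_sub_one_le (le_maxTerm_right e f j) hv hs)

theorem dworkSystem_factorialRatio (hsum : ∑ i, e i = ∑ j, f j)
    (h0 : ∀ x ∈ Set.Icc (0 : ℝ) 1, 0 ≤ landauDelta e f x)
    (h1 : ∀ x ∈ Set.Ico (1 / (maxTerm e f : ℝ)) 1, 1 ≤ landauDelta e f x) :
    DworkSystem p (p : ℝ)⁻¹ (fun n => (factorialRatio e f n : ℚ_[p]))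
      (fun n => (p : ℝ)⁻¹ ^ #(largeExponents p (maxTerm e f) n)) (AllLarge p (maxTerm e f)) := by
  have hp := (Fact.out : p.Prime)
  have hpi : (p : ℝ)⁻¹ < 1 := inv_lt_one_of_one_lt₀ (by exact_mod_cast hp.one_lt)
  have hpi0 : 0 < (p : ℝ)⁻¹ := inv_pos.2 (by exact_mod_cast hp.pos)
  have hQ : ∀ n, (factorialRatio e f n : ℚ_[p]) ≠ 0 := fun n => by
    exact_mod_cast (factorialRatio_pos n).ne'
  have hgood : ∀ n s m, n < p ^ s → GoodDigits p (AllLarge p (maxTerm e f)) s n →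
      ‖(factorialRatio e f (n + p ^ s * m) / factorialRatio e f n : ℚ_[p])‖ ≤
        (p : ℝ)⁻¹ ^ #(largeExponents p (maxTerm e f) m) := fun n s m hn hg =>
    norm_factorialRatio_add_div_le p hsum h0 h1 m hn (mul_lt_of_goodDigits hp.one_lt hn hg)
  refine ⟨hp.pos, hpi0.le, by simp [factorialRatio_zero], hQ, fun n => pow_nonneg hpi0.le _,
    fun n => pow_le_one₀ hpi0.le hpi.le, norm_factorialRatio_le p hsum h0 h1,
    fun n t m hn hb => ?_, hgood, fun n s m hn hg => ?_⟩
  · rw [← pow_add]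
    exact pow_le_pow_of_le_one hpi0.le hpi.le (card_largeExponents_add hp.one_lt hn hb)
  · have hn' : n / p < p ^ s := Nat.div_lt_of_lt_mul (by rwa [← pow_succ'])
    have hs := card_largeExponents_le_of_goodDigits hp.one_lt hn hg
    have hvu : n % p + p * (n / p) = n := Nat.mod_add_div n p
    have hR := norm_factorialRatio_ratio_sub_one_le (p := p) hsum (v := n % p) (u := n / p) (s := s)
      (m := m) (Nat.mod_lt _ hp.pos) (by rwa [hvu])
    rw [mul_add, ← mul_assoc, ← pow_succ', ← add_assoc, hvu] at hR
    have hY := hgood (n / p) s m hn' hg.1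
    -- Relative error times the shorter quotient: the precision lost in the first factor is exactly
    -- restored by the weight at `n`, and the second factor supplies the weight at `m`.
    have : (factorialRatio e f (n + p ^ (s + 1) * m) / factorialRatio e f n -
        factorialRatio e f (n / p + p ^ s * m) / factorialRatio e f (n / p) : ℚ_[p]) =
        ((factorialRatio e f (n + p ^ (s + 1) * m) / factorialRatio e f (n / p + p ^ s * m)) /
          (factorialRatio e f n / factorialRatio e f (n / p)) - 1) *
        (factorialRatio e f (n / p + p ^ s * m) / factorialRatio e f (n / p)) := by
      have a1 := hQ n
      have a2 := hQ (n / p)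
      have a3 := hQ (n / p + p ^ s * m)
      field_simp
    rw [this, norm_mul]
    calc _ ≤ (p : ℝ)⁻¹ ^ (s + 1 - #(largeExponents p (maxTerm e f) n)) *
          (p : ℝ)⁻¹ ^ #(largeExponents p (maxTerm e f) m) *
          (p : ℝ)⁻¹ ^ #(largeExponents p (maxTerm e f) n) :=
          mul_le_mul_of_nonneg_right (mul_le_mul hR hY (norm_nonneg _) (pow_nonneg hpi0.le _))
            (pow_nonneg hpi0.le _)
      _ = (p : ℝ)⁻¹ ^ (s + 1 - #(largeExponents p (maxTerm e f) n)) *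
          (p : ℝ)⁻¹ ^ #(largeExponents p (maxTerm e f) n) *
          (p : ℝ)⁻¹ ^ #(largeExponents p (maxTerm e f) m) := by ring
      _ = _ := by rw [← pow_add, Nat.sub_add_cancel (by omega)]

end FactorialRatioDwork

/-! ### Harmonic numbers in `ℚ_[p]`. -/

section Harmonic

open Finset

variable {p : ℕ} [Fact p.Prime]

theorem norm_harmonic_add_sub_le {N c : ℕ} {C : ℝ} (hC : 0 ≤ C)
    (h : ∀ k, 1 ≤ k → k ≤ c → ‖((N + k : ℕ) : ℚ_[p])⁻¹‖ ≤ C) :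
    ‖(harmonic (N + c) - harmonic N : ℚ_[p])‖ ≤ C := by
  have : (harmonic (N + c) - harmonic N : ℚ_[p]) =
      ∑ k ∈ range c, ((N + (k + 1) : ℕ) : ℚ_[p])⁻¹ := by
    rw [harmonic, harmonic, sum_range_add, Rat.cast_add, add_sub_cancel_left]
    push_cast
    exact sum_congr rfl fun k _ => by rw [add_assoc]
  rw [this]
  exact norm_sum_le_of_ultra hC fun k hk => h (k + 1) (by omega) (mem_range.1 hk)

theorem norm_inv_natCast_le {n k : ℕ} (hn : n ≠ 0) (h : padicValNat p n ≤ k) :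
    ‖(n : ℚ_[p])⁻¹‖ ≤ ((p : ℝ)⁻¹ ^ k)⁻¹ := by
  rw [norm_inv]
  refine inv_anti₀ (pow_pos (inv_pos.2 ?_) _) (inv_pow_le_norm_natCast hn h)
  exact_mod_cast (Fact.out : p.Prime).pos

/-- The reciprocals of the multiples of `p`, once multiplied by `p`, sum to `H_N`; the other
reciprocals are `p`-integral. -/
theorem norm_p_mul_harmonic_sub_le {r : ℕ} (N : ℕ) (hr : r < p) :
    ‖(p * harmonic (p * N + r) - harmonic N : ℚ_[p])‖ ≤ (p : ℝ)⁻¹ := by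
  have hp := (Fact.out : p.Prime)
  have hpi0 : 0 ≤ (p : ℝ)⁻¹ := by positivity
  have hstep : ∀ N r, r < p →
      ‖(p * harmonic (p * N + r) - p * harmonic (p * N) : ℚ_[p])‖ ≤ (p : ℝ)⁻¹ := by
    intro N r hr
    rw [← mul_sub, norm_mul, Padic.norm_p]
    refine mul_le_of_le_one_right hpi0 (norm_harmonic_add_sub_le zero_le_one fun k h1 h2 => ?_)
    have hnd : ¬ p ∣ p * N + k := by
      rw [Nat.dvd_add_right (Dvd.intro _ rfl)]
      exact fun h => by have := Nat.le_of_dvd (by omega) h; omega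
    simpa using norm_inv_natCast_le (p := p) (k := 0) (n := p * N + k) (by omega)
      (padicValNat.eq_zero_of_not_dvd hnd).le
  have hbase : ∀ N, ‖(p * harmonic (p * N) - harmonic N : ℚ_[p])‖ ≤ (p : ℝ)⁻¹ := by
    intro N
    induction N with
    | zero => simp
    | succ N ih =>
      have h1 := hstep N (p - 1) (Nat.sub_lt hp.pos one_pos)
      have h2 := norm_sub_le_trans h1 ih
      have e1 : p * (N + 1) = p * N + (p - 1) + 1 := by
        have := hp.pos
        rw [mul_add]; omega
      have e2 : (p : ℚ_[p]) * harmonic (p * (N + 1)) - harmonic (N + 1) =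
          p * harmonic (p * N + (p - 1)) - harmonic N := by
        have hp0 : (p : ℚ_[p]) ≠ 0 := by exact_mod_cast hp.ne_zero
        have hN : ((N : ℚ_[p]) + 1) ≠ 0 := by exact_mod_cast N.succ_ne_zero
        rw [e1, harmonic_succ, harmonic_succ, ← e1]
        push_cast
        field_simp
        ring
      rwa [e2]
  exact norm_sub_le_trans (hstep N r hr) (hbase N)

/-- The condition on `H` needed for summation by parts. The arguments differ by `a p ^ s (k % p)`,
and no denominator in between has valuation above `s` plus the number of large exponents of `k`. -/
theorem norm_harmonic_block_sub_le {a M : ℕ} (ha : a ≤ M) (s k : ℕ) :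
    ‖(harmonic (a * (p ^ s * k)) - harmonic (a * (p ^ (s + 1) * (k / p))) : ℚ_[p])‖ *
      (p : ℝ)⁻¹ ^ #(largeExponents p M k) * (p : ℝ)⁻¹ ^ s ≤ 1 := by
  have hp := (Fact.out : p.Prime)
  have hpi0 : 0 < (p : ℝ)⁻¹ := inv_pos.2 (by exact_mod_cast hp.pos)
  have hk : a * (p ^ s * k) = a * (p ^ (s + 1) * (k / p)) + a * (p ^ s * (k % p)) := by
    conv_lhs => rw [← Nat.mod_add_div k p]
    ring
  rw [hk, mul_assoc, ← pow_add, add_comm _ s]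
  have hpos := pow_pos hpi0 (s + #(largeExponents p M k))
  refine (le_div_iff₀ hpos).1 ?_
  rw [one_div]
  refine norm_harmonic_add_sub_le (inv_nonneg.2 hpos.le) fun j h1 h2 => ?_
  refine norm_inv_natCast_le (by omega) ?_
  have := padicValNat_le_add_card_largeExponents (p := p) (u := k / p) ha (Nat.mod_lt k hp.pos) h1 h2
  rwa [Nat.mod_add_div] at this

end Harmonic

/-! ### The congruence `p G(z) F(z^p) ≡ F(z) G(z^p)` modulo `p`. -/

section CongruenceFG

open Finset

theorem coeff_mul_expand {R : Type*} [CommRing R] {p : ℕ} (hp : p ≠ 0) (S T : R⟦X⟧) {v : ℕ} (hv : v < p)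
    (K : ℕ) : coeff (v + p * K) (S * expand p hp T) =
      ∑ j ∈ range (K + 1), coeff (v + p * j) S * coeff (K - j) T := by
  rw [← sum_range_reflect, mul_comm S, coeff_mul, Nat.sum_antidiagonal_eq_sum_range_succ_mk]
  have hinj : Function.Injective fun j => p * j := fun a b h =>
    Nat.eq_of_mul_eq_mul_left (Nat.pos_of_ne_zero hp) h
  symm
  refine sum_of_injOn (fun j => p * j) (hinj.injOn) ?_ ?_ ?_
  · intro j hj
    have := Nat.mul_le_mul_left p (Nat.lt_succ_iff.1 (mem_range.1 hj))
    simp only [coe_range, Set.mem_Iio]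
    omega
  · intro i hi hi'
    rw [coeff_expand_of_not_dvd, zero_mul]
    rintro ⟨j, rfl⟩
    refine hi' ⟨j, ?_, rfl⟩
    simp only [coe_range, Set.mem_Iio]
    by_contra! h
    have := Nat.mul_le_mul_left p h
    have := mem_range.1 hi
    rw [Nat.mul_succ] at *
    omega
  · intro j hj
    have := mem_range.1 hj
    have h2 : v + p * K - p * j = v + p * (K - j) := by
      obtain ⟨d, rfl⟩ := Nat.exists_eq_add_of_le (Nat.lt_succ_iff.1 this)
      rw [Nat.add_sub_cancel_left, mul_add]; omega
    simp only [coeff_expand_mul]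
    rw [show K + 1 - 1 - j = K - j by omega, show K - (K - j) = j by omega, h2, mul_comm]

variable {q₁ q₂ : ℕ} {e : Fin q₁ → ℕ} {f : Fin q₂ → ℕ} {p : ℕ} [Fact p.Prime]

/-- Pass through `p H_{apj}`. The first difference may have denominators, but the valuation of `Q(v
+ pj)` cancels them; the second is divisible by `p`. -/
theorem norm_factorialRatio_mul_harmonic_sub_le (hsum : ∑ i, e i = ∑ j, f j)
    (h0 : ∀ x ∈ Set.Icc (0 : ℝ) 1, 0 ≤ landauDelta e f x)
    (h1 : ∀ x ∈ Set.Ico (1 / (maxTerm e f : ℝ)) 1, 1 ≤ landauDelta e f x) {a v : ℕ}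
    (ha : a ≤ maxTerm e f) (hv : v < p) (j : ℕ) :
    ‖(factorialRatio e f (v + p * j) *
      (p * harmonic (a * (v + p * j)) - harmonic (a * j)) : ℚ_[p])‖ ≤ (p : ℝ)⁻¹ := by
  have hp := (Fact.out : p.Prime)
  have hpi0 : 0 < (p : ℝ)⁻¹ := inv_pos.2 (by exact_mod_cast hp.pos)
  have hpos := pow_pos hpi0 #(largeExponents p (maxTerm e f) (v + p * j))
  have hQ := norm_factorialRatio_le p hsum h0 h1 (v + p * j)
  have hQ1 := norm_factorialRatio_le_one p hsum h0 (v + p * j)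
  have hA : ‖(factorialRatio e f (v + p * j) *
      (p * (harmonic (a * (p * j) + a * v) - harmonic (a * (p * j)))) : ℚ_[p])‖ ≤ (p : ℝ)⁻¹ := by
    have hH : ‖(harmonic (a * (p * j) + a * v) - harmonic (a * (p * j)) : ℚ_[p])‖ ≤
        ((p : ℝ)⁻¹ ^ #(largeExponents p (maxTerm e f) (v + p * j)))⁻¹ :=
      norm_harmonic_add_sub_le (inv_nonneg.2 hpos.le) fun k h1 h2 =>
        norm_inv_natCast_le (by omega) (padicValNat_le_card_largeExponents ha hv h1 h2)
    rw [norm_mul, norm_mul, Padic.norm_p, mul_left_comm]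
    refine mul_le_of_le_one_right hpi0.le ?_
    exact (mul_le_mul hQ hH (norm_nonneg _) hpos.le).trans_eq (mul_inv_cancel₀ hpos.ne')
  have hB : ‖(factorialRatio e f (v + p * j) *
      (p * harmonic (p * (a * j) + 0) - harmonic (a * j)) : ℚ_[p])‖ ≤ (p : ℝ)⁻¹ := by
    rw [norm_mul]
    exact (mul_le_of_le_one_left (norm_nonneg _) hQ1).trans
      (norm_p_mul_harmonic_sub_le _ hp.pos)
  have := (IsUltrametricDist.norm_add_le_max _ _).trans (max_le hA hB)
  rw [← mul_add, add_zero, show p * (a * j) = a * (p * j) by ring] at this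
  rw [show a * (v + p * j) = a * (p * j) + a * v by ring]
  refine (congrArg norm ?_).trans_le this
  ring

/-- Replace `p H_{a(v+pj)}` by `H_{aj}`, then reflect `j ↦ K - j` in the other half: what remains is
`H_{aj}` summed against the cross terms. -/
theorem norm_sum_factorialRatio_harmonic_le (hsum : ∑ i, e i = ∑ j, f j)
    (h0 : ∀ x ∈ Set.Icc (0 : ℝ) 1, 0 ≤ landauDelta e f x)
    (h1 : ∀ x ∈ Set.Ico (1 / (maxTerm e f : ℝ)) 1, 1 ≤ landauDelta e f x) {a v : ℕ}
    (ha : a ≤ maxTerm e f) (hv : v < p) (K : ℕ) :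
    ‖∑ j ∈ range (K + 1), (factorialRatio e f (v + p * j) * factorialRatio e f (K - j) *
      (p * harmonic (a * (v + p * j)) - harmonic (a * (K - j))) : ℚ_[p])‖ ≤ (p : ℝ)⁻¹ := by
  have hp := (Fact.out : p.Prime)
  have hpi0 : 0 < (p : ℝ)⁻¹ := inv_pos.2 (by exact_mod_cast hp.pos)
  have hD := (dworkSystem_factorialRatio (p := p) hsum h0 h1).norm_sum_mul_crossTerm_le hp.one_lt hv
    (fun n => (harmonic (a * n) : ℚ_[p])) (by simp) (norm_harmonic_block_sub_le ha) K
  have hrefl : ∑ j ∈ range (K + 1), (factorialRatio e f (v + p * j) * factorialRatio e f (K - j) *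
      harmonic (a * (K - j)) : ℚ_[p]) = ∑ j ∈ range (K + 1), (factorialRatio e f (v + p * (K - j)) *
      factorialRatio e f j * harmonic (a * j) : ℚ_[p]) := by
    rw [← sum_range_reflect]
    refine sum_congr rfl fun j hj => ?_
    have := mem_range.1 hj
    rw [show K + 1 - 1 - j = K - j by omega, show K - (K - j) = j by omega]
  have hcross : ∑ j ∈ range (K + 1), (harmonic (a * j) : ℚ_[p]) *
      crossTerm (fun n => (factorialRatio e f n : ℚ_[p])) p v K j =
      ∑ j ∈ range (K + 1), (factorialRatio e f (v + p * j) * factorialRatio e f (K - j) *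
        (harmonic (a * j) - harmonic (a * (K - j))) : ℚ_[p]) := by
    simp only [mul_sub, sum_sub_distrib]
    rw [hrefl, ← sum_sub_distrib]
    refine sum_congr rfl fun j hj => ?_
    rw [crossTerm, if_pos (Nat.lt_succ_iff.1 (mem_range.1 hj))]
    ring
  rw [hcross] at hD
  rw [← sub_zero (∑ j ∈ range (K + 1), _ : ℚ_[p])]
  refine norm_sub_le_trans ?_ (by rwa [sub_zero])
  rw [← sum_sub_distrib]
  refine norm_sum_le_of_ultra hpi0.le fun j _ => ?_
  have hA := norm_factorialRatio_mul_harmonic_sub_le hsum h0 h1 ha hv j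
  have hQ := norm_factorialRatio_le_one p hsum h0 (K - j)
  have := mul_le_mul hA hQ (norm_nonneg _) hpi0.le
  rw [← norm_mul, mul_one] at this
  refine (congrArg norm ?_).trans_le this
  ring

/-- The coefficient of `Q(n)` in `seriesG`. -/
def harmonicWeight {q₁ q₂ : ℕ} (e : Fin q₁ → ℕ) (f : Fin q₂ → ℕ) (n : ℕ) : ℚ :=
  ∑ i, (e i : ℚ) * harmonic (e i * n) - ∑ j, (f j : ℚ) * harmonic (f j * n)

theorem norm_natCast_mul_le {x : ℚ_[p]} {C : ℝ} (n : ℕ) (hx : ‖x‖ ≤ C) : ‖(n : ℚ_[p]) * x‖ ≤ C := by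
  rw [norm_mul]
  exact (mul_le_of_le_one_left (norm_nonneg _)
    (by exact_mod_cast Padic.norm_int_le_one (p := p) n)).trans hx

theorem norm_sum_harmonicWeight_le (hsum : ∑ i, e i = ∑ j, f j)
    (h0 : ∀ x ∈ Set.Icc (0 : ℝ) 1, 0 ≤ landauDelta e f x)
    (h1 : ∀ x ∈ Set.Ico (1 / (maxTerm e f : ℝ)) 1, 1 ≤ landauDelta e f x) {v : ℕ}
    (hv : v < p) (K : ℕ) :
    ‖∑ j ∈ range (K + 1), (factorialRatio e f (v + p * j) * factorialRatio e f (K - j) *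
      (p * harmonicWeight e f (v + p * j) - harmonicWeight e f (K - j)) : ℚ_[p])‖ ≤
        (p : ℝ)⁻¹ := by
  have hpi0 : 0 ≤ (p : ℝ)⁻¹ := by positivity
  have hE := norm_sum_le_of_ultra (t := univ) hpi0 fun i (_ : i ∈ univ) =>
    norm_natCast_mul_le (e i) (norm_sum_factorialRatio_harmonic_le (p := p) hsum h0 h1
      (le_maxTerm_left e f i) hv K)
  have hF := norm_sum_le_of_ultra (t := univ) hpi0 fun j (_ : j ∈ univ) =>
    norm_natCast_mul_le (f j) (norm_sum_factorialRatio_harmonic_le (p := p) hsum h0 h1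
      (le_maxTerm_right e f j) hv K)
  have := norm_sub_le_of_ultra hE hF
  refine (congrArg norm ?_).trans_le this
  simp only [mul_sum]
  rw [sum_comm, sum_comm (s := univ) (t := range (K + 1)), ← sum_sub_distrib]
  refine sum_congr rfl fun j _ => ?_
  simp only [harmonicWeight]
  push_cast
  have comb : ∀ {ι : Type} [Fintype ι] (g : ι → ℕ) (x y : ℚ_[p]) (u w : ι → ℚ_[p]),
      ∑ i, (g i : ℚ_[p]) * (x * (y * u i - w i)) =
        x * (y * ∑ i, (g i : ℚ_[p]) * u i - ∑ i, (g i : ℚ_[p]) * w i) := by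
    intro ι _ g x y u w
    rw [mul_sum, ← sum_sub_distrib, mul_sum]
    exact sum_congr rfl fun i _ => by ring
  rw [comb, comb]
  ring

theorem norm_coeff_seriesG_mul_expand_sub_le (hsum : ∑ i, e i = ∑ j, f j)
    (h0 : ∀ x ∈ Set.Icc (0 : ℝ) 1, 0 ≤ landauDelta e f x)
    (h1 : ∀ x ∈ Set.Ico (1 / (maxTerm e f : ℝ)) 1, 1 ≤ landauDelta e f x) (hp : p ≠ 0) (n : ℕ) :
    ‖((coeff n (C (p : ℚ) * (seriesG e f * expand p hp (seriesF e f)) -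
      seriesF e f * expand p hp (seriesG e f)) : ℚ) : ℚ_[p])‖ ≤ (p : ℝ)⁻¹ := by
  have hv := Nat.mod_lt n (Nat.pos_of_ne_zero hp)
  have := norm_sum_harmonicWeight_le (p := p) hsum h0 h1 hv (n / p)
  refine (congrArg norm ?_).trans_le this
  conv_lhs => rw [← Nat.mod_add_div n p]
  rw [map_sub, coeff_C_mul, coeff_mul_expand hp _ _ hv, coeff_mul_expand hp _ _ hv, mul_sum,
    ← sum_sub_distrib]
  simp only [seriesF, seriesG, coeff_mk]
  push_cast
  refine sum_congr rfl fun j _ => ?_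
  simp only [harmonicWeight]
  push_cast
  ring

end CongruenceFG

/-! ### Exponentials of power series through logarithmic derivatives. -/

section ExpSubst

/-- Two series with constant term `1` and the same logarithmic derivative agree. -/
theorem eq_of_derivative_eq_mul {R : Type*} [Field R] [CharZero R] {S T g : R⟦X⟧} (hS : derivative R S = S * g)
    (hT : derivative R T = T * g) (hS0 : constantCoeff S = 1) (hT0 : constantCoeff T = 1) :
    S = T := by
  have hTne : constantCoeff T ≠ 0 := by rw [hT0]; exact one_ne_zero
  have hmul := PowerSeries.mul_inv_cancel T hTne
  have : S * T⁻¹ = 1 := by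
    refine derivative.ext ?_ (by simp [hS0, hT0])
    rw [derivative_one, Derivation.leibniz, derivative_inv', hS, hT, smul_eq_mul, smul_eq_mul]
    linear_combination (-(S * g * T⁻¹)) * hmul
  calc S = S * (T * T⁻¹) := by rw [hmul, mul_one]
    _ = (S * T⁻¹) * T := by ring
    _ = T := by rw [this, one_mul]

variable {R : Type*} [Field R] [Algebra ℚ R]

theorem derivative_exp_subst {f : R⟦X⟧} (hf : constantCoeff f = 0) :
    derivative R ((PowerSeries.exp R).subst f) =
      (PowerSeries.exp R).subst f * derivative R f := by
  rw [derivative_subst (HasSubst.of_constantCoeff_zero' hf), derivative_exp]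

theorem constantCoeff_exp_subst {f : R⟦X⟧} (hf : constantCoeff f = 0) :
    constantCoeff ((PowerSeries.exp R).subst f) = 1 := by
  have hc := constantCoeff_subst_eq_zero hf (PowerSeries.exp R - 1) (by simp)
  have hs := HasSubst.of_constantCoeff_zero' hf
  rw [subst_sub hs] at hc
  have h1 : (1 : R⟦X⟧).subst f = (1 : R⟦X⟧) := by
    rw [← coe_substAlgHom hs, map_one]
  rw [h1] at hc
  have : constantCoeff ((PowerSeries.exp R).subst f - 1 : R⟦X⟧) = 0 := hc
  rw [map_sub, map_one, sub_eq_zero] at this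
  exact this

variable [CharZero R]

theorem exp_subst_add {f g : R⟦X⟧} (hf : constantCoeff f = 0) (hg : constantCoeff g = 0) :
    (PowerSeries.exp R).subst (f + g) =
      (PowerSeries.exp R).subst f * (PowerSeries.exp R).subst g := by
  have hfg : constantCoeff (f + g) = 0 := by simp [hf, hg]
  refine eq_of_derivative_eq_mul (derivative_exp_subst hfg) ?_ (constantCoeff_exp_subst hfg)
    (by rw [map_mul, constantCoeff_exp_subst hf, constantCoeff_exp_subst hg, one_mul])
  rw [Derivation.leibniz, derivative_exp_subst hf, derivative_exp_subst hg, map_add, smul_eq_mul,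
    smul_eq_mul]
  ring

theorem exp_subst_nsmul {f : R⟦X⟧} (hf : constantCoeff f = 0) (n : ℕ) :
    (PowerSeries.exp R).subst (n • f) = (PowerSeries.exp R).subst f ^ n := by
  induction n with
  | zero =>
    have h0 : constantCoeff (0 • f) = 0 := by simp
    refine eq_of_derivative_eq_mul (derivative_exp_subst h0) ?_ (constantCoeff_exp_subst h0)
      (by simp)
    simp
  | succ n ih =>
    rw [succ_nsmul, exp_subst_add (by simp [hf]) hf, ih, pow_succ]

end ExpSubst

/-! ### The Dieudonné–Dwork criterion. -/

section DieudonneDwork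

open Finset

variable {p : ℕ} [Fact p.Prime]

theorem norm_coeff_mul_le {S T : ℚ_[p]⟦X⟧} {C D : ℝ} (hC : 0 ≤ C) (hD : 0 ≤ D)
    (hS : ∀ n, ‖coeff n S‖ ≤ C) (hT : ∀ n, ‖coeff n T‖ ≤ D) (n : ℕ) :
    ‖coeff n (S * T)‖ ≤ C * D := by
  rw [coeff_mul]
  refine norm_sum_le_of_ultra (mul_nonneg hC hD) fun i _ => ?_
  rw [norm_mul]
  exact mul_le_mul (hS _) (hT _) (norm_nonneg _) hC

theorem norm_coeff_inv_le {S : ℚ_[p]⟦X⟧} (h0 : constantCoeff S = 1) (hS : ∀ n, ‖coeff n S‖ ≤ 1)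
    (n : ℕ) : ‖coeff n S⁻¹‖ ≤ 1 := by
  induction n using Nat.strong_induction_on with
  | _ n ih =>
  rw [coeff_inv, h0]
  split_ifs with hn
  · simp
  · rw [inv_one, neg_one_mul, norm_neg]
    refine norm_sum_le_of_ultra zero_le_one fun i _ => ?_
    split_ifs with hi
    · rw [norm_mul]
      exact mul_le_one₀ (hS _) (norm_nonneg _) (ih _ hi)
    · simp

/-- For `d ≥ 1` the valuation of `d!` is less than `d`, so `p ^ d / d!` is still divisible by `p`,
even for `p = 2`. -/
theorem norm_coeff_exp_subst_le {φ : ℚ_[p]⟦X⟧} (h0 : constantCoeff φ = 0)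
    (hφ : ∀ n, ‖coeff n φ‖ ≤ (p : ℝ)⁻¹) {n : ℕ} (hn : n ≠ 0) :
    ‖coeff n ((PowerSeries.exp ℚ_[p]).subst φ)‖ ≤ (p : ℝ)⁻¹ := by
  have hp := (Fact.out : p.Prime)
  have hpi0 : 0 < (p : ℝ)⁻¹ := inv_pos.2 (by exact_mod_cast hp.pos)
  have hpow : ∀ d n, ‖coeff n (φ ^ d)‖ ≤ (p : ℝ)⁻¹ ^ d := by
    intro d
    induction d with
    | zero => intro n; rw [pow_zero, pow_zero, coeff_one]; split_ifs <;> simp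
    | succ d ih =>
      intro n
      rw [pow_succ, pow_succ]
      exact norm_coeff_mul_le (pow_nonneg hpi0.le _) hpi0.le ih hφ n
  rw [coeff_subst' (HasSubst.of_constantCoeff_zero' h0)]
  refine finsum_induction (fun x : ℚ_[p] => ‖x‖ ≤ (p : ℝ)⁻¹) (by simp)
    (fun x y hx hy => (IsUltrametricDist.norm_add_le_max x y).trans (max_le hx hy)) fun d => ?_
  rcases Nat.eq_zero_or_pos d with rfl | hd
  · rw [pow_zero, coeff_one, if_neg hn, smul_zero, norm_zero]
    exact hpi0.le
  · rw [coeff_exp, smul_eq_mul, norm_mul]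
    have h1 : ‖algebraMap ℚ ℚ_[p] (1 / d.factorial)‖ ≤ ((p : ℝ)⁻¹ ^ (d - 1))⁻¹ := by
      have := norm_inv_natCast_le (p := p) (n := d.factorial) (k := d - 1) d.factorial_ne_zero
        (Nat.le_sub_one_of_lt (padicValNat_factorial_lt_of_ne_zero p hd.ne'))
      simpa using this
    have hpos := pow_pos hpi0 (d - 1)
    calc _ ≤ ((p : ℝ)⁻¹ ^ (d - 1))⁻¹ * (p : ℝ)⁻¹ ^ d :=
          mul_le_mul h1 (hpow d n) (norm_nonneg _) (inv_nonneg.2 hpos.le)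
      _ = (p : ℝ)⁻¹ := by
        obtain ⟨c, rfl⟩ : ∃ c, d = c + 1 := ⟨d - 1, by omega⟩
        rw [Nat.add_sub_cancel] at hpos ⊢
        rw [pow_succ, inv_mul_cancel_left₀ hpos.ne']

theorem norm_coeff_pow_sub_expand_le (P : ℤ_[p]⟦X⟧) (hp : p ≠ 0) (n : ℕ) :
    ‖coeff n (P ^ p - expand p hp P)‖ ≤ (p : ℝ)⁻¹ := by
  have hmod : PowerSeries.map (PadicInt.toZMod (p := p)) (P ^ p - expand p hp P) = 0 := by
    rw [map_sub, map_pow, map_expand, sub_eq_zero]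
    have := MvPowerSeries.map_frobenius_expand p hp (R := ZMod p)
      (f := PowerSeries.map (PadicInt.toZMod (p := p)) P)
    rw [ZMod.frobenius_zmod, MvPowerSeries.map_id] at this
    exact this.symm
  have h1 : PadicInt.toZMod (coeff n (P ^ p - expand p hp P)) = 0 := by
    rw [← coeff_map, hmod, map_zero]
  rw [← RingHom.mem_ker, PadicInt.ker_toZMod, PadicInt.maximalIdeal_eq_span_p] at h1
  have h2 := (PadicInt.norm_le_pow_iff_mem_span_pow (coeff n (P ^ p - expand p hp P)) 1).2
    (by simpa using h1)
  simpa using h2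

/-- The Dieudonné–Dwork criterion for the integrality of an exponential. -/
theorem norm_coeff_exp_subst_le_one {f : ℚ_[p]⟦X⟧} (h0 : constantCoeff f = 0) (hp : p ≠ 0)
    (hf : ∀ n, ‖coeff n (p • f - expand p hp f)‖ ≤ (p : ℝ)⁻¹) (n : ℕ) :
    ‖coeff n ((PowerSeries.exp ℚ_[p]).subst f)‖ ≤ 1 := by
  have hpp := (Fact.out : p.Prime)
  have hpi0 : 0 < (p : ℝ)⁻¹ := inv_pos.2 (by exact_mod_cast hpp.pos)
  set φ := p • f - expand p hp f
  have hφ0 : constantCoeff φ = 0 := by simp [φ, h0]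
  set E : ℚ_[p]⟦X⟧ := (PowerSeries.exp ℚ_[p]).subst f with hE
  set V : ℚ_[p]⟦X⟧ := (PowerSeries.exp ℚ_[p]).subst φ with hV
  have hE0 : constantCoeff E = 1 := constantCoeff_exp_subst h0
  have hV0 : constantCoeff V = 1 := constantCoeff_exp_subst hφ0
  have hEV : E ^ p = expand p hp E * V := by
    have hx : expand p hp E = (PowerSeries.exp ℚ_[p]).subst (expand p hp f) :=
      PowerSeries.expand_subst p hp (HasSubst.of_constantCoeff_zero' h0) _
    rw [hx, hE, ← exp_subst_nsmul h0, hV,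
      ← exp_subst_add (by simp [h0]) hφ0]
    congr 1
    simp [φ]
  induction n using Nat.strong_induction_on with
  | _ n ih =>
  rcases Nat.eq_zero_or_pos n with rfl | hn
  · rw [coeff_zero_eq_constantCoeff_apply, hE0]; simp
  -- Let `P` be the truncation of `E` below degree `n`, integral by induction. In degree `n`, `E ^
  -- p` exceeds `P ^ p` by `p` times the coefficient of `E`, while `P ^ p ≡ P(z^p)` and `E ^ p ≡
  -- E(z^p)` modulo `p`.
  have hlift : ∀ i, ∃ z : ℤ_[p], (z : ℚ_[p]) = if i < n then coeff i E else 0 := fun i => by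
    split_ifs with h
    · exact ⟨⟨coeff i E, ih i h⟩, rfl⟩
    · exact ⟨0, rfl⟩
  choose c hc using hlift
  set P' : ℤ_[p]⟦X⟧ := PowerSeries.mk c with hP'
  set P : ℚ_[p]⟦X⟧ := PowerSeries.map (algebraMap ℤ_[p] ℚ_[p]) P' with hP
  have hPcoeff : ∀ i, coeff i P = if i < n then coeff i E else 0 := fun i => by
    rw [hP, coeff_map, hP', coeff_mk, ← hc]; rfl
  have hPlt : ∀ i < n, coeff i P = coeff i E := fun i hi => by rw [hPcoeff, if_pos hi]
  have hPn : coeff n P = 0 := by rw [hPcoeff, if_neg (lt_irrefl n)]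
  obtain ⟨T, hT⟩ : X ^ n ∣ E - P := by
    rw [X_pow_dvd_iff]
    intro i hi
    rw [map_sub, hPlt i hi, sub_self]
  have hE' : E = P + X ^ n * T := by rw [← hT]; ring
  have hTn : constantCoeff T = coeff n E := by
    have h1 := congrArg (coeff n) hE'
    have h2 := coeff_X_pow_mul T n 0
    rw [zero_add] at h2
    rw [map_add, hPn, zero_add, h2, coeff_zero_eq_constantCoeff_apply] at h1
    exact h1.symm
  have hP0 : constantCoeff P = 1 := by
    rw [← coeff_zero_eq_constantCoeff_apply, hPlt 0 hn, coeff_zero_eq_constantCoeff_apply, hE0]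
  have hpow : coeff n (E ^ p) = coeff n (P ^ p) + p * coeff n E := by
    obtain ⟨k, hk⟩ := Polynomial.powAddExpansion P (X ^ n * T) p
    rw [← hE'] at hk
    have e1 : (p : ℚ_[p]⟦X⟧) * P ^ (p - 1) * (X ^ n * T) + k * (X ^ n * T) ^ 2 =
        X ^ n * ((p : ℚ_[p]⟦X⟧) * P ^ (p - 1) * T + X ^ n * (k * T ^ 2)) := by ring
    rw [hk, add_assoc, e1, map_add]
    congr 1
    have := coeff_X_pow_mul ((p : ℚ_[p]⟦X⟧) * P ^ (p - 1) * T + X ^ n * (k * T ^ 2)) n 0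
    rw [zero_add] at this
    rw [this, coeff_zero_eq_constantCoeff_apply, map_add, map_mul, map_mul, map_mul, map_pow, hP0,
      hTn, map_pow, constantCoeff_X, zero_pow hn.ne']
    simp
  have hfrob : ‖coeff n (P ^ p) - coeff n (expand p hp P)‖ ≤ (p : ℝ)⁻¹ := by
    have h1 := norm_coeff_pow_sub_expand_le P' hp n
    have h2 : coeff n (P ^ p) - coeff n (expand p hp P) =
        ((coeff n (P' ^ p - expand p hp P') : ℤ_[p]) : ℚ_[p]) := by
      rw [hP, ← map_pow, ← map_expand, coeff_map, coeff_map, ← map_sub, ← map_sub]; rfl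
    rw [h2]
    exact h1
  have hdiv : n / p < n := Nat.div_lt_self hn hpp.one_lt
  have hexp : coeff n (expand p hp P) = coeff n (expand p hp E) := by
    rw [coeff_expand, coeff_expand, hPlt _ hdiv]
  have hprod : ‖coeff n (expand p hp E * V) - coeff n (expand p hp E)‖ ≤ (p : ℝ)⁻¹ := by
    rw [coeff_mul, Nat.sum_antidiagonal_eq_sum_range_succ_mk, sum_range_succ, Nat.sub_self,
      coeff_zero_eq_constantCoeff_apply, hV0, mul_one, add_sub_cancel_right]
    refine norm_sum_le_of_ultra hpi0.le fun i hi => ?_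
    have hi' := mem_range.1 hi
    rw [norm_mul]
    refine (mul_le_of_le_one_left (norm_nonneg _) ?_).trans
      (norm_coeff_exp_subst_le hφ0 hf (by omega))
    rw [coeff_expand]
    split_ifs
    · exact ih _ ((Nat.div_le_self _ _).trans_lt hi')
    · simp
  rw [← hEV, hpow, ← hexp] at hprod
  have hfin := norm_sub_le_of_ultra hprod hfrob
  have e2 : coeff n (P ^ p) + p * coeff n E - coeff n (expand p hp P) -
      (coeff n (P ^ p) - coeff n (expand p hp P)) = p * coeff n E := by ring
  rw [e2, norm_mul, Padic.norm_p] at hfin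
  exact le_of_mul_le_mul_left (by simpa using hfin) hpi0

end DieudonneDwork

/-! ### Integrality of the canonical coordinate. -/

section Integrality

open Finset

theorem exists_int_eq_of_norm_le_one {x : ℚ}
    (h : ∀ (p : ℕ) [Fact p.Prime], ‖(x : ℚ_[p])‖ ≤ 1) : ∃ k : ℤ, x = k := by
  by_contra! hx
  have hden : x.den ≠ 1 := fun h1 => hx x.num ((Rat.den_eq_one_iff x).1 h1).symm
  obtain ⟨p, hp, hpd⟩ := Nat.exists_prime_and_dvd hden
  have : Fact p.Prime := ⟨hp⟩
  have hnum : ‖((x.num : ℤ) : ℚ_[p])‖ = 1 := by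
    rw [Padic.norm_intCast_eq_one_iff, Int.isCoprime_iff_gcd_eq_one]
    exact x.reduced.coprime_dvd_right hpd
  have hd : ‖((x.den : ℕ) : ℚ_[p])‖ < 1 := Padic.norm_natCast_lt_one_iff.2 hpd
  have hne : ((x.den : ℕ) : ℚ_[p]) ≠ 0 := by exact_mod_cast x.den_ne_zero
  have hmul : (x : ℚ_[p]) * (x.den : ℕ) = (x.num : ℤ) := by
    exact_mod_cast Rat.mul_den_eq_num x
  have := congrArg norm hmul
  rw [norm_mul, hnum] at this
  have := mul_lt_one_of_nonneg_of_lt_one_right (h p) (norm_nonneg _) hd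
  linarith

variable {q₁ q₂ : ℕ} {e : Fin q₁ → ℕ} {f : Fin q₂ → ℕ}

theorem constantCoeff_map_seriesF {R : Type*} [CommRing R] (φ : ℚ →+* R) (e : Fin q₁ → ℕ)
    (f : Fin q₂ → ℕ) : constantCoeff (PowerSeries.map φ (seriesF e f)) = 1 := by
  rw [← coeff_zero_eq_constantCoeff_apply, coeff_map, coeff_zero_eq_constantCoeff_apply,
    constantCoeff_seriesF, map_one]

theorem constantCoeff_map_seriesG {R : Type*} [CommRing R] (φ : ℚ →+* R) (e : Fin q₁ → ℕ)
    (f : Fin q₂ → ℕ) : constantCoeff (PowerSeries.map φ (seriesG e f)) = 0 := by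
  rw [← coeff_zero_eq_constantCoeff_apply, coeff_map, coeff_zero_eq_constantCoeff_apply,
    constantCoeff_seriesG, map_zero]

theorem map_canonicalCoordinate {R : Type*} [Field R] [Algebra ℚ R] (e : Fin q₁ → ℕ)
    (f : Fin q₂ → ℕ) : PowerSeries.map (algebraMap ℚ R) (canonicalCoordinate e f) =
      X * (PowerSeries.exp R).subst (PowerSeries.map (algebraMap ℚ R) (seriesG e f) *
        (PowerSeries.map (algebraMap ℚ R) (seriesF e f))⁻¹) := by
  rw [canonicalCoordinate, map_mul, map_X]
  congr 1
  have h := PowerSeries.map_subst (hasSubst_seriesG_mul_inv e f) (h := algebraMap ℚ R)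
    (PowerSeries.exp ℚ)
  have h2 : PowerSeries.map (algebraMap ℚ R) (seriesF e f)⁻¹ =
      (PowerSeries.map (algebraMap ℚ R) (seriesF e f))⁻¹ := by
    have hc : constantCoeff (PowerSeries.map (algebraMap ℚ R) (seriesF e f)) ≠ 0 := by
      rw [constantCoeff_map_seriesF]; exact one_ne_zero
    rw [PowerSeries.eq_inv_iff_mul_eq_one hc, ← map_mul, mul_comm, seriesF_mul_inv, map_one]
  rw [map_exp] at h
  refine h.trans ?_
  congr 1
  exact (map_mul (PowerSeries.map (algebraMap ℚ R)) _ _).trans (by rw [h2])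

variable (p : ℕ) [Fact p.Prime]

theorem norm_coeff_map_seriesF_le (hsum : ∑ i, e i = ∑ j, f j)
    (h0 : ∀ x ∈ Set.Icc (0 : ℝ) 1, 0 ≤ landauDelta e f x) (n : ℕ) :
    ‖coeff n (PowerSeries.map (algebraMap ℚ ℚ_[p]) (seriesF e f))‖ ≤ 1 := by
  rw [coeff_map, seriesF, coeff_mk]
  exact norm_factorialRatio_le_one p hsum h0 n

theorem norm_coeff_exp_quotient_le_one (hsum : ∑ i, e i = ∑ j, f j)
    (h0 : ∀ x ∈ Set.Icc (0 : ℝ) 1, 0 ≤ landauDelta e f x)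
    (h1 : ∀ x ∈ Set.Ico (1 / (maxTerm e f : ℝ)) 1, 1 ≤ landauDelta e f x) (n : ℕ) :
    ‖coeff n ((PowerSeries.exp ℚ_[p]).subst
      (PowerSeries.map (algebraMap ℚ ℚ_[p]) (seriesG e f) *
        (PowerSeries.map (algebraMap ℚ ℚ_[p]) (seriesF e f))⁻¹))‖ ≤ 1 := by
  have hp : p ≠ 0 := (Fact.out : p.Prime).ne_zero
  have hFn := norm_coeff_map_seriesF_le p hsum h0
  set F := PowerSeries.map (algebraMap ℚ ℚ_[p]) (seriesF e f) with hF
  set G := PowerSeries.map (algebraMap ℚ ℚ_[p]) (seriesG e f) with hG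
  have hF0 : constantCoeff F = 1 := constantCoeff_map_seriesF _ e f
  have hG0 : constantCoeff G = 0 := constantCoeff_map_seriesG _ e f
  refine norm_coeff_exp_subst_le_one (by simp [hG0]) hp (fun n => ?_) n
  have hFF : F * F⁻¹ = 1 := PowerSeries.mul_inv_cancel F (by simp [hF0])
  have hEF : expand p hp F * expand p hp F⁻¹ = 1 := by rw [← map_mul, hFF, map_one]
  -- Multiplying by `F(z) F(z^p)` clears denominators; as `F` is integral with constant term `1`,
  -- its inverse costs no precision.
  have hsplit : p • (G * F⁻¹) - expand p hp (G * F⁻¹) =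
      PowerSeries.map (algebraMap ℚ ℚ_[p]) (C (p : ℚ) * (seriesG e f * expand p hp (seriesF e f)) -
        seriesF e f * expand p hp (seriesG e f)) * (F⁻¹ * expand p hp F⁻¹) := by
    simp only [map_sub, map_mul, map_expand, map_natCast, nsmul_eq_mul, ← hF, ← hG]
    linear_combination (expand p hp G * expand p hp F⁻¹) * hFF -
      ((p : ℚ_[p]⟦X⟧) * G * F⁻¹) * hEF
  have hinv := norm_coeff_inv_le hF0 hFn
  have hinv' : ∀ n, ‖coeff n (expand p hp F⁻¹)‖ ≤ 1 := fun n => by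
    rw [coeff_expand]
    split_ifs
    · exact hinv _
    · simp
  rw [hsplit]
  refine (norm_coeff_mul_le (C := (p : ℝ)⁻¹) (D := 1) (by positivity) zero_le_one (fun n => ?_)
    (fun n => ?_) n).trans_eq (mul_one _)
  · rw [coeff_map]
    exact norm_coeff_seriesG_mul_expand_sub_le hsum h0 h1 hp n
  · exact (norm_coeff_mul_le zero_le_one zero_le_one hinv hinv' n).trans_eq (mul_one _)

theorem memXMulInt_canonicalCoordinate (hsum : ∑ i, e i = ∑ j, f j)
    (h0 : ∀ x ∈ Set.Icc (0 : ℝ) 1, 0 ≤ landauDelta e f x)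
    (h1 : ∀ x ∈ Set.Ico (1 / (maxTerm e f : ℝ)) 1, 1 ≤ landauDelta e f x) :
    MemXMulInt (canonicalCoordinate e f) := by
  have hint : ∀ n, ∃ k : ℤ, coeff (n + 1) (canonicalCoordinate e f) = k := fun n => by
    refine exists_int_eq_of_norm_le_one fun p _ => ?_
    have h := norm_coeff_exp_quotient_le_one p hsum h0 h1 n
    rw [← coeff_succ_X_mul, ← map_canonicalCoordinate, coeff_map] at h
    exact h
  choose k hk using hint
  refine ⟨PowerSeries.mk k, ?_⟩
  ext n
  rcases n with _ | n
  · simp [canonicalCoordinate]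
  · rw [hk, coeff_succ_X_mul, coeff_map, coeff_mk]; rfl

end Integrality

/-! ### Landau's criterion for integrality. -/

section LandauCriterion

open Finset

variable {q₁ q₂ : ℕ} {e : Fin q₁ → ℕ} {f : Fin q₂ → ℕ}

/-- With `D = c d`, `⌊c x⌋ = ⌊⌊D x⌋ / d⌋`. Hence for `x ≥ 0` the value `Δ(x)` depends only on `⌊M!
x⌋`. -/
theorem floor_mul_eq_div {c D : ℕ} (hc : 0 < c) (hD : 0 < D) (h : c ∣ D) {x : ℝ} (hx : 0 ≤ x) :
    ⌊(c : ℝ) * x⌋ = ((c * ⌊(D : ℝ) * x⌋₊ / D : ℕ) : ℤ) := by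
  obtain ⟨d, rfl⟩ := h
  have hd : 0 < d := Nat.pos_of_mul_pos_left hD
  rw [Nat.mul_div_mul_left _ _ hc, ← Nat.floor_div_natCast, Int.natCast_floor_eq_floor
    (by positivity)]
  congr 1
  have : (d : ℝ) ≠ 0 := by exact_mod_cast hd.ne'
  push_cast
  field_simp

theorem dvd_factorial_maxTerm_left (he : ∀ i, 0 < e i) (i : Fin q₁) :
    e i ∣ (maxTerm e f).factorial :=
  Nat.dvd_factorial (he i) (le_maxTerm_left e f i)

theorem dvd_factorial_maxTerm_right (hf : ∀ j, 0 < f j) (j : Fin q₂) :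
    f j ∣ (maxTerm e f).factorial :=
  Nat.dvd_factorial (hf j) (le_maxTerm_right e f j)

theorem landauDelta_eq_landauNat (he : ∀ i, 0 < e i) (hf : ∀ j, 0 < f j) {x : ℝ} (hx : 0 ≤ x) :
    landauDelta e f x = landauNat e f ⌊((maxTerm e f).factorial : ℝ) * x⌋₊
      (maxTerm e f).factorial := by
  have hD := Nat.factorial_pos (maxTerm e f)
  rw [landauDelta, landauNat]
  congr 1
  · exact sum_congr rfl fun i _ => floor_mul_eq_div (he i) hD (dvd_factorial_maxTerm_left he i) hx
  · exact sum_congr rfl fun j _ => floor_mul_eq_div (hf j) hD (dvd_factorial_maxTerm_right hf j) hx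

/-- For `a = ⌊N p / D⌋ + 1` and `p > D`, the point `a / p` lies strictly between `N / D` and `(N +
1) / D`, an interval free of multiples of `1 / c`. -/
theorem mul_div_eq_of_lt_prime {c D N p : ℕ} (hc : 0 < c) (hD : 0 < D) (h : c ∣ D) (hp : D < p) :
    c * (N * p / D + 1) / p = c * N / D := by
  obtain ⟨d, rfl⟩ := h
  have hd : 0 < d := Nat.pos_of_mul_pos_left hD
  have hp0 : 0 < p := by omega
  set a := N * p / (c * d) + 1
  have h1 : N * p < c * d * a := Nat.lt_mul_div_succ _ hD
  have h2 : c * d * a ≤ N * p + c * d := by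
    have := Nat.mul_div_le (N * p) (c * d)
    simp only [a, mul_add, mul_one]; omega
  rw [Nat.mul_div_mul_left _ _ hc]
  have hN := Nat.div_add_mod N d
  have hr := Nat.mod_lt N hd
  set q := N / d
  refine Nat.div_eq_of_lt_le ?_ ?_
  · refine Nat.le_of_mul_le_mul_left (c := d) ?_ hd
    have : d * q * p ≤ N * p := Nat.mul_le_mul_right _ (by omega)
    nlinarith
  · refine Nat.lt_of_mul_lt_mul_left (a := d) ?_
    have : (N + 1) * p ≤ d * (q + 1) * p := Nat.mul_le_mul_right _ (by rw [mul_add]; omega)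
    nlinarith

theorem landauNat_eq_of_lt_prime (he : ∀ i, 0 < e i) (hf : ∀ j, 0 < f j) {N p : ℕ}
    (hp : (maxTerm e f).factorial < p) :
    landauNat e f (N * p / (maxTerm e f).factorial + 1) p =
      landauNat e f N (maxTerm e f).factorial := by
  have hD := Nat.factorial_pos (maxTerm e f)
  rw [landauNat, landauNat]
  congr 1
  · exact sum_congr rfl fun i _ => by
      rw [mul_div_eq_of_lt_prime (he i) hD (dvd_factorial_maxTerm_left he i) hp]
  · exact sum_congr rfl fun j _ => by
      rw [mul_div_eq_of_lt_prime (hf j) hD (dvd_factorial_maxTerm_right hf j) hp]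

theorem mul_div_add_one_lt {D N p : ℕ} (hN : N < D) (hp : D < p) : N * p / D + 1 < p := by
  have h := mul_div_eq_of_lt_prime (c := 1) (N := N) one_pos (by omega) (one_dvd D) hp
  rw [one_mul, one_mul, Nat.div_eq_of_lt hN, Nat.div_eq_zero_iff] at h
  omega

theorem floor_mul_lt {D : ℕ} (hD : 0 < D) {x : ℝ} (hx : x < 1) : ⌊(D : ℝ) * x⌋₊ < D := by
  rw [Nat.floor_lt' hD.ne']
  exact mul_lt_of_lt_one_right (by exact_mod_cast hD) hx

/-- Since `M a < p ^ 2`, only `l = 1` counts in Legendre's formula. -/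
theorem norm_factorialRatio_of_lt_prime {p a : ℕ} [Fact p.Prime] (hM : maxTerm e f ≤ p)
    (ha : a < p) : ‖(factorialRatio e f a : ℚ_[p])‖ = (p : ℝ)⁻¹ ^ landauNat e f a p := by
  have hlt : maxTerm e f * a < p ^ 2 := by
    have hp := (Fact.out : p.Prime).pos
    rw [sq]
    exact (Nat.mul_le_mul_right a hM).trans_lt (Nat.mul_lt_mul_of_pos_left ha hp)
  rw [norm_factorialRatio p hlt, show Icc 1 2 = {1, 2} by rfl, sum_pair (by norm_num), pow_one,
    landauNat_eq_zero hlt, add_zero]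

theorem landauDelta_nonneg_of_integral (he : ∀ i, 0 < e i) (hf : ∀ j, 0 < f j)
    (hsum : ∑ i, e i = ∑ j, f j) (hint : ∀ n : ℕ, ∃ k : ℤ, factorialRatio e f n = k) :
    ∀ x ∈ Set.Icc (0 : ℝ) 1, 0 ≤ landauDelta e f x := by
  rintro x ⟨hx0, hx1⟩
  rcases hx1.eq_or_lt with rfl | hx1
  · have hs : (∑ i, (e i : ℤ)) = ∑ j, (f j : ℤ) := by exact_mod_cast hsum
    simp [landauDelta, hs]
  by_contra! hneg
  have hD := Nat.factorial_pos (maxTerm e f)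
  obtain ⟨p, hpD, hp⟩ := Nat.exists_infinite_primes ((maxTerm e f).factorial + 1)
  have : Fact p.Prime := ⟨hp⟩
  have hMp : maxTerm e f ≤ p := (Nat.self_le_factorial _).trans (by omega)
  rw [landauDelta_eq_landauNat he hf hx0,
    ← landauNat_eq_of_lt_prime he hf (p := p) (by omega)] at hneg
  set a := ⌊((maxTerm e f).factorial : ℝ) * x⌋₊ * p / (maxTerm e f).factorial + 1
  have ha : a < p := mul_div_add_one_lt (floor_mul_lt hD hx1) (by omega)
  have hnorm := norm_factorialRatio_of_lt_prime (e := e) (f := f) hMp ha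
  obtain ⟨k, hk⟩ := hint a
  have hle : ‖(factorialRatio e f a : ℚ_[p])‖ ≤ 1 := by
    rw [hk]; exact_mod_cast Padic.norm_int_le_one (p := p) k
  have hgt := one_lt_zpow_of_neg₀ (a := (p : ℝ)⁻¹) (inv_pos.2 (by exact_mod_cast hp.pos))
    (inv_lt_one_of_one_lt₀ (by exact_mod_cast hp.one_lt)) hneg
  rw [← hnorm] at hgt
  linarith

theorem integral_iff_landauDelta_nonneg (he : ∀ i, 0 < e i) (hf : ∀ j, 0 < f j)
    (hsum : ∑ i, e i = ∑ j, f j) : (∀ n : ℕ, ∃ k : ℤ, factorialRatio e f n = k) ↔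
      ∀ x ∈ Set.Icc (0 : ℝ) 1, 0 ≤ landauDelta e f x :=
  ⟨landauDelta_nonneg_of_integral he hf hsum, fun h0 n =>
    exists_int_eq_of_norm_le_one fun p _ => norm_factorialRatio_le_one p hsum h0 n⟩

end LandauCriterion

/-! ### Positivity of the harmonic weight at a zero of `Δ`. -/

section HarmonicDifference

open Finset

variable {q₁ q₂ : ℕ} {e : Fin q₁ → ℕ} {f : Fin q₂ → ℕ}

/-- The floor jumps to `j` exactly when `(k + 1) / D = j / c`, and there `D / (k + 1)` equals the
new summand `c / j`. -/
theorem mul_harmonic_div {c D : ℕ} (hc : 0 < c) (hD : 0 < D) (h : c ∣ D) (N : ℕ) :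
    (c : ℚ) * harmonic (c * N / D) = D * ∑ k ∈ range N,
      (((c * (k + 1) / D : ℕ) : ℚ) - ((c * k / D : ℕ) : ℚ)) / ((k + 1 : ℕ) : ℚ) := by
  obtain ⟨d, rfl⟩ := h
  have hd : 0 < d := Nat.pos_of_mul_pos_left hD
  have hc' : (c : ℚ) ≠ 0 := by exact_mod_cast hc.ne'
  have hd' : (d : ℚ) ≠ 0 := by exact_mod_cast hd.ne'
  simp only [Nat.mul_div_mul_left _ _ hc]
  induction N with
  | zero => simp
  | succ N ih =>
    rw [sum_range_succ, mul_add, ← ih, Nat.succ_div]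
    split_ifs with hdvd
    · obtain ⟨m, hm⟩ := hdvd
      have hm' : N / d + 1 = m := by
        have h1 := Nat.succ_div (a := N) (b := d)
        rw [if_pos ⟨m, hm⟩, hm, Nat.mul_div_cancel_left _ hd] at h1
        exact h1.symm
      have hm0 : (m : ℚ) ≠ 0 := by
        rw [← hm']; exact_mod_cast Nat.succ_ne_zero (N / d)
      rw [harmonic_succ, hm', hm]
      have : ((N / d : ℕ) : ℚ) = m - 1 := by rw [← hm']; push_cast; ring
      rw [this]
      push_cast
      field_simp
      ring
    · simp

/-- `∑ᵢ eᵢ H_{⌊eᵢ N / D⌋} - ∑ⱼ fⱼ H_{⌊fⱼ N / D⌋}` -/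
def floorHarmonicWeight {q₁ q₂ : ℕ} (e : Fin q₁ → ℕ) (f : Fin q₂ → ℕ) (N D : ℕ) : ℚ :=
  ∑ i, (e i : ℚ) * harmonic (e i * N / D) - ∑ j, (f j : ℚ) * harmonic (f j * N / D)

/-- Abel summation; the term `k = 0` is read with `1 / 0 = 0`. -/
theorem sum_div_by_parts (δ : ℕ → ℚ) (N : ℕ) (h0 : δ 0 = 0) :
    ∑ k ∈ range N, (δ (k + 1) - δ k) / ((k + 1 : ℕ) : ℚ) =
      δ N / N + ∑ k ∈ range N, δ k * (1 / k - 1 / ((k + 1 : ℕ) : ℚ)) := by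
  induction N with
  | zero => simp [h0]
  | succ N ih =>
    rw [sum_range_succ, sum_range_succ, ih]
    ring

theorem floorHarmonicWeight_eq (he : ∀ i, 0 < e i) (hf : ∀ j, 0 < f j) (N : ℕ) :
    floorHarmonicWeight e f N (maxTerm e f).factorial = (maxTerm e f).factorial *
      ((landauNat e f N (maxTerm e f).factorial : ℚ) / N +
        ∑ k ∈ range N, (landauNat e f k (maxTerm e f).factorial : ℚ) *
          (1 / k - 1 / ((k + 1 : ℕ) : ℚ))) := by
  have hD := Nat.factorial_pos (maxTerm e f)
  rw [← sum_div_by_parts (fun k => (landauNat e f k (maxTerm e f).factorial : ℚ)) N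
    (by simp [landauNat]), floorHarmonicWeight,
    sum_congr rfl fun i _ => mul_harmonic_div (he i) hD (dvd_factorial_maxTerm_left he i) N,
    sum_congr rfl fun j _ => mul_harmonic_div (hf j) hD (dvd_factorial_maxTerm_right hf j) N,
    ← mul_sum, ← mul_sum, ← mul_sub, sum_comm, sum_comm (s := univ) (t := range N),
    ← sum_sub_distrib]
  congr 1
  refine sum_congr rfl fun k _ => ?_
  rw [← sum_div, ← sum_div, ← sub_div]
  congr 1
  simp only [landauNat, Int.cast_sub, Int.cast_sum, Int.cast_natCast]
  rw [sum_sub_distrib, sum_sub_distrib]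
  ring

theorem exists_eq_maxTerm (hne : 0 < q₁) :
    (∃ i, e i = maxTerm e f) ∨ ∃ j, f j = maxTerm e f := by
  rcases le_total (univ.sup f) (univ.sup e) with h | h
  · left
    have : (univ : Finset (Fin q₁)).Nonempty := ⟨⟨0, hne⟩, mem_univ _⟩
    obtain ⟨i, _, hi⟩ := exists_mem_eq_sup univ this e
    exact ⟨i, by rw [maxTerm, max_eq_left h, hi]⟩
  · rcases (univ : Finset (Fin q₂)).eq_empty_or_nonempty with h0 | h0
    · left
      have : (univ : Finset (Fin q₁)).Nonempty := ⟨⟨0, hne⟩, mem_univ _⟩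
      obtain ⟨i, _, hi⟩ := exists_mem_eq_sup univ this e
      refine ⟨i, ?_⟩
      rw [maxTerm, h0, sup_empty, ← hi]
      exact (max_eq_left bot_le).symm
    · right
      obtain ⟨j, _, hj⟩ := exists_mem_eq_sup univ h0 f
      exact ⟨j, by rw [maxTerm, max_eq_right h, hj]⟩

theorem mul_div_maxTerm {c M k : ℕ} (hk : 0 < k) (hcM : c ≤ M) (hM : 0 < M) :
    c * k / (M * k) = if c = M then 1 else 0 := by
  rw [Nat.mul_div_mul_right _ _ hk]
  split_ifs with h
  · rw [h, Nat.div_self hM]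
  · exact Nat.div_eq_of_lt (lt_of_le_of_ne hcM h)

/-- The Landau function does not vanish at `1 / M`, because the two sequences are disjoint. -/
theorem landauNat_ne_zero (hne : 0 < q₁) (hdisj : ∀ i j, e i ≠ f j) {k : ℕ} (hk : 0 < k)
    (hM : 0 < maxTerm e f) : landauNat e f k (maxTerm e f * k) ≠ 0 := by
  simp only [landauNat, mul_div_maxTerm hk (le_maxTerm_left e f _) hM,
    mul_div_maxTerm hk (le_maxTerm_right e f _) hM]
  rcases exists_eq_maxTerm (e := e) (f := f) hne with ⟨i, hi⟩ | ⟨j, hj⟩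
  · have h2 : ∀ j, f j ≠ maxTerm e f := fun j hj => hdisj i j (hi.trans hj.symm)
    have h1 := single_le_sum (f := fun i => (((if e i = maxTerm e f then 1 else 0 : ℕ)) : ℤ))
      (fun _ _ => by positivity) (mem_univ i)
    simp only [hi, if_true] at h1
    simp only [h2, if_false, Nat.cast_zero, sum_const_zero, sub_zero]
    push_cast at h1 ⊢
    omega
  · have h2 : ∀ i, e i ≠ maxTerm e f := fun i hi => hdisj i j (hi.trans hj.symm)
    have h1 := single_le_sum (f := fun j => (((if f j = maxTerm e f then 1 else 0 : ℕ)) : ℤ))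
      (fun _ _ => by positivity) (mem_univ j)
    simp only [hj, if_true] at h1
    simp only [h2, if_false, Nat.cast_zero, sum_const_zero, zero_sub]
    push_cast at h1 ⊢
    omega

/-- After Abel summation the boundary term vanishes with `Δ(N / D)` and the others are nonnegative.
The index `k = D / M`, which is below `N`, contributes strictly because `Δ(1 / M) ≠ 0`. -/
theorem floorHarmonicWeight_pos (hne : 0 < q₁) (he : ∀ i, 0 < e i) (hf : ∀ j, 0 < f j)
    (hdisj : ∀ i j, e i ≠ f j) (hsum : ∑ i, e i = ∑ j, f j)
    (h0 : ∀ x ∈ Set.Icc (0 : ℝ) 1, 0 ≤ landauDelta e f x) {N : ℕ}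
    (hN : (maxTerm e f).factorial ≤ maxTerm e f * N)
    (hz : landauNat e f N (maxTerm e f).factorial = 0) :
    0 < floorHarmonicWeight e f N (maxTerm e f).factorial := by
  have hM : 0 < maxTerm e f := (he ⟨0, hne⟩).trans_le (le_maxTerm_left e f _)
  have hD := Nat.factorial_pos (maxTerm e f)
  obtain ⟨k, hk⟩ := Nat.dvd_factorial hM le_rfl
  have hk0 : 0 < k := Nat.pos_of_mul_pos_left (hk ▸ hD)
  have hkne : landauNat e f k (maxTerm e f).factorial ≠ 0 := by
    rw [hk]; exact landauNat_ne_zero hne hdisj hk0 hM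
  have hkN : k < N := by
    rw [hk] at hN
    refine lt_of_le_of_ne (Nat.le_of_mul_le_mul_left hN hM) ?_
    rintro rfl
    exact hkne hz
  have hnn := landauNat_nonneg hsum h0 hD
  have hfac : ∀ k : ℕ, 0 < k → (0 : ℚ) < 1 / k - 1 / ((k + 1 : ℕ) : ℚ) := fun k hk => by
    have : (0 : ℚ) < k := by exact_mod_cast hk
    rw [sub_pos]
    exact one_div_lt_one_div_of_lt this (by push_cast; linarith)
  rw [floorHarmonicWeight_eq he hf, hz, Int.cast_zero, zero_div, zero_add]
  refine mul_pos (by exact_mod_cast hD) (sum_pos' (fun i _ => ?_) ⟨k, mem_range.2 hkN, ?_⟩)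
  · rcases Nat.eq_zero_or_pos i with rfl | hi
    · simp [landauNat]
    · exact mul_nonneg (by exact_mod_cast hnn i) (hfac i hi).le
  · exact mul_pos (by exact_mod_cast lt_of_le_of_ne (hnn k) hkne.symm) (hfac k hk0)

theorem floorHarmonicWeight_eq_of_lt_prime (he : ∀ i, 0 < e i) (hf : ∀ j, 0 < f j) {N p : ℕ}
    (hp : (maxTerm e f).factorial < p) :
    floorHarmonicWeight e f (N * p / (maxTerm e f).factorial + 1) p =
      floorHarmonicWeight e f N (maxTerm e f).factorial := by
  have hD := Nat.factorial_pos (maxTerm e f)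
  rw [floorHarmonicWeight, floorHarmonicWeight]
  congr 1
  · exact sum_congr rfl fun i _ => by
      rw [mul_div_eq_of_lt_prime (he i) hD (dvd_factorial_maxTerm_left he i) hp]
  · exact sum_congr rfl fun j _ => by
      rw [mul_div_eq_of_lt_prime (hf j) hD (dvd_factorial_maxTerm_right hf j) hp]

end HarmonicDifference

/-! ### Obstruction to integrality at large primes. -/

section NonIntegrality

open Finset

variable {q₁ q₂ : ℕ} {e : Fin q₁ → ℕ} {f : Fin q₂ → ℕ} {p : ℕ} [Fact p.Prime]

/-- The derivative of `g` is `E' / E`, which is integral, and positive degrees below `p` are units.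
-/
theorem norm_coeff_le_one_of_exp_subst {g : ℚ_[p]⟦X⟧} (h0 : constantCoeff g = 0)
    (hE : ∀ n, ‖coeff n ((PowerSeries.exp ℚ_[p]).subst g)‖ ≤ 1) {n : ℕ} (hn : n < p) :
    ‖coeff n g‖ ≤ 1 := by
  rcases n with _ | n
  · rw [coeff_zero_eq_constantCoeff_apply, h0]; simp
  set E : ℚ_[p]⟦X⟧ := (PowerSeries.exp ℚ_[p]).subst g with hEdef
  have hE0 : constantCoeff E = 1 := constantCoeff_exp_subst h0
  have hder : derivative ℚ_[p] g = E⁻¹ * derivative ℚ_[p] E := by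
    rw [hEdef, derivative_exp_subst h0, ← mul_assoc, PowerSeries.inv_mul_cancel, one_mul]
    rw [constantCoeff_exp_subst h0]; exact one_ne_zero
  have hE' : ∀ m, ‖coeff m (derivative ℚ_[p] E)‖ ≤ 1 := fun m => by
    rw [coeff_derivative, mul_comm]
    exact_mod_cast norm_natCast_mul_le (m + 1) (hE (m + 1))
  have h := norm_coeff_mul_le zero_le_one zero_le_one (norm_coeff_inv_le hE0 hE) hE' n
  have hunit : ‖((n + 1 : ℕ) : ℚ_[p])‖ = 1 := by
    rw [Padic.norm_natCast_eq_one_iff, (Fact.out : p.Prime).coprime_iff_not_dvd]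
    exact fun h => by have := Nat.le_of_dvd (by omega) h; omega
  push_cast at hunit
  rwa [← hder, coeff_derivative, norm_mul, hunit, mul_one, mul_one] at h

theorem norm_floorHarmonicWeight_sub_le (n : ℕ) :
    ‖(p * harmonicWeight e f n - floorHarmonicWeight e f n p : ℚ_[p])‖ ≤ (p : ℝ)⁻¹ := by
  have hpi0 : 0 ≤ (p : ℝ)⁻¹ := by positivity
  have hterm : ∀ c : ℕ, ‖(c * (p * harmonic (c * n) - harmonic (c * n / p)) : ℚ_[p])‖ ≤
      (p : ℝ)⁻¹ := fun c => by
    have h := norm_p_mul_harmonic_sub_le (p := p) (c * n / p)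
      (Nat.mod_lt (c * n) (Fact.out : p.Prime).pos)
    rw [Nat.div_add_mod] at h
    exact norm_natCast_mul_le c h
  have hE := norm_sum_le_of_ultra (t := univ) hpi0 fun i (_ : i ∈ univ) => hterm (e i)
  have hF := norm_sum_le_of_ultra (t := univ) hpi0 fun j (_ : j ∈ univ) => hterm (f j)
  refine (congrArg norm ?_).trans_le (norm_sub_le_of_ultra hE hF)
  simp only [harmonicWeight, floorHarmonicWeight]
  push_cast
  simp only [mul_sub, sum_sub_distrib, mul_sum, mul_left_comm (p : ℚ_[p])]
  ring

theorem norm_seriesG_le_one_of_memXMulPadicInt (hsum : ∑ i, e i = ∑ j, f j)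
    (h0 : ∀ x ∈ Set.Icc (0 : ℝ) 1, 0 ≤ landauDelta e f x)
    (h : MemXMulPadicInt p (canonicalCoordinate e f)) {a : ℕ} (ha : a < p) :
    ‖(factorialRatio e f a * harmonicWeight e f a : ℚ_[p])‖ ≤ 1 := by
  obtain ⟨s, hs⟩ := h
  rw [map_canonicalCoordinate] at hs
  have hs := X_mul_cancel hs
  have hFn := norm_coeff_map_seriesF_le p hsum h0
  set F := PowerSeries.map (algebraMap ℚ ℚ_[p]) (seriesF e f) with hF
  set G := PowerSeries.map (algebraMap ℚ ℚ_[p]) (seriesG e f) with hG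
  have hF0 : constantCoeff F = 1 := constantCoeff_map_seriesF _ e f
  have hG0 : constantCoeff G = 0 := constantCoeff_map_seriesG _ e f
  have hE : ∀ n, ‖coeff n ((PowerSeries.exp ℚ_[p]).subst (G * F⁻¹))‖ ≤ 1 := fun n => by
    rw [hs, coeff_map]
    exact PadicInt.norm_le_one _
  have hg0 : constantCoeff (G * F⁻¹) = 0 := by rw [map_mul, hG0, zero_mul]
  have hGF : G = G * F⁻¹ * F := by
    rw [mul_assoc, PowerSeries.inv_mul_cancel F (by rw [hF0]; exact one_ne_zero), mul_one]
  have hcoeff : (factorialRatio e f a * harmonicWeight e f a : ℚ_[p]) = coeff a G := by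
    rw [hG, coeff_map, seriesG, coeff_mk]
    exact (Rat.cast_mul _ _).symm
  rw [hcoeff, hGF, coeff_mul]
  refine norm_sum_le_of_ultra zero_le_one fun i hi => ?_
  have hi' : i.1 ≤ a := Finset.HasAntidiagonal.mem_antidiagonal.1 hi ▸ Nat.le_add_right _ _
  rw [norm_mul]
  exact mul_le_one₀ (norm_coeff_le_one_of_exp_subst hg0 hE (hi'.trans_lt ha)) (norm_nonneg _)
    (hFn _)

/-- At the chosen `a < p`, `Q(a)` is a unit because `Δ(a / p) = 0`. Integrality of the coefficient
of `G` there makes `p` times the harmonic weight divisible by `p`, and this is congruent to a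
nonzero rational independent of `p`. -/
theorem le_of_memXMulPadicInt (he : ∀ i, 0 < e i) (hf : ∀ j, 0 < f j)
    (hsum : ∑ i, e i = ∑ j, f j)
    (h0 : ∀ x ∈ Set.Icc (0 : ℝ) 1, 0 ≤ landauDelta e f x) {N : ℕ}
    (hN : N < (maxTerm e f).factorial) (hz : landauNat e f N (maxTerm e f).factorial = 0)
    (hW : 0 < floorHarmonicWeight e f N (maxTerm e f).factorial)
    (h : MemXMulPadicInt p (canonicalCoordinate e f)) :
    p ≤ max (maxTerm e f).factorial
      (floorHarmonicWeight e f N (maxTerm e f).factorial).num.natAbs := by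
  by_contra! hlt
  obtain ⟨hpD, hpW⟩ := max_lt_iff.1 hlt
  have hp := (Fact.out : p.Prime)
  have hMp : maxTerm e f ≤ p := (Nat.self_le_factorial _).trans hpD.le
  set a := N * p / (maxTerm e f).factorial + 1 with ha_def
  have ha : a < p := mul_div_add_one_lt hN hpD
  have hQ := norm_factorialRatio_of_lt_prime (e := e) (f := f) hMp ha
  rw [landauNat_eq_of_lt_prime he hf hpD, hz, zpow_zero] at hQ
  have hG := norm_seriesG_le_one_of_memXMulPadicInt hsum h0 h ha
  rw [norm_mul, hQ, one_mul] at hG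
  have hsub := norm_floorHarmonicWeight_sub_le (e := e) (f := f) (p := p) a
  rw [floorHarmonicWeight_eq_of_lt_prime he hf hpD] at hsub
  set W := floorHarmonicWeight e f N (maxTerm e f).factorial
  have hpw : ‖(p * harmonicWeight e f a : ℚ_[p])‖ ≤ (p : ℝ)⁻¹ := by
    rw [norm_mul, Padic.norm_p]
    exact mul_le_of_le_one_right (by positivity) hG
  have hWn : ‖(W : ℚ_[p])‖ ≤ (p : ℝ)⁻¹ := by
    have := norm_sub_le_of_ultra hpw hsub
    rwa [sub_sub_cancel] at this
  have hWlt : ‖(W : ℚ_[p])‖ < 1 :=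
    hWn.trans_lt (inv_lt_one_of_one_lt₀ (by exact_mod_cast hp.one_lt))
  have hnum : ‖((W.num : ℤ) : ℚ_[p])‖ < 1 := by
    have hmul : ((W.num : ℤ) : ℚ_[p]) = (W.den : ℕ) * (W : ℚ_[p]) := by
      rw [mul_comm]; exact_mod_cast (Rat.mul_den_eq_num W).symm
    rw [hmul]
    exact (norm_natCast_mul_le W.den le_rfl).trans_lt hWlt
  rw [Padic.norm_intCast_lt_one_iff] at hnum
  have hne : W.num ≠ 0 := (Rat.num_pos.2 hW).ne'
  have := Nat.le_of_dvd (Int.natAbs_pos.2 hne) (Int.natCast_dvd.1 hnum)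
  omega

end NonIntegrality

/-! ### Finiteness of the good primes, and the theorem. -/

theorem finite_memXMulPadicInt {q₁ q₂ : ℕ} {e : Fin q₁ → ℕ} {f : Fin q₂ → ℕ}
    (hne : 0 < q₁) (he : ∀ i, 0 < e i) (hf : ∀ j, 0 < f j)
    (hdisj : ∀ i j, e i ≠ f j) (hsum : ∑ i, e i = ∑ j, f j)
    (h0 : ∀ x ∈ Set.Icc (0 : ℝ) 1, 0 ≤ landauDelta e f x)
    (hz : ∃ x ∈ Set.Ico (1 / (maxTerm e f : ℝ)) 1, landauDelta e f x = 0) :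
    {p : ℕ | ∃ _ : Fact p.Prime, MemXMulPadicInt p (canonicalCoordinate e f)}.Finite := by
  obtain ⟨x, ⟨hx0, hx1⟩, hx⟩ := hz
  have hM : 0 < maxTerm e f := (he ⟨0, hne⟩).trans_le (le_maxTerm_left e f _)
  have hM' : (0 : ℝ) < maxTerm e f := by exact_mod_cast hM
  have hxpos : 0 ≤ x := (by positivity : (0 : ℝ) ≤ 1 / maxTerm e f).trans hx0
  have hD := Nat.factorial_pos (maxTerm e f)
  rw [landauDelta_eq_landauNat he hf hxpos] at hx
  set N := ⌊((maxTerm e f).factorial : ℝ) * x⌋₊ with hN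
  have hNlt : N < (maxTerm e f).factorial := floor_mul_lt hD hx1
  -- The bound `x ≥ 1 / M` survives rounding down to `N / M!`, because `1 / M` is itself a multiple
  -- of `1 / M!`.
  have hNge : (maxTerm e f).factorial ≤ maxTerm e f * N := by
    obtain ⟨k, hk⟩ := Nat.dvd_factorial hM le_rfl
    have hkN : k ≤ N := by
      refine Nat.le_floor ?_
      rw [div_le_iff₀ hM'] at hx0
      rw [hk]
      push_cast
      nlinarith [Nat.cast_nonneg (α := ℝ) k]
    calc _ = maxTerm e f * k := hk
      _ ≤ _ := Nat.mul_le_mul_left _ hkN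
  have hW := floorHarmonicWeight_pos hne he hf hdisj hsum h0 hNge hx
  refine (Set.finite_Iic (max (maxTerm e f).factorial
    (floorHarmonicWeight e f N (maxTerm e f).factorial).num.natAbs)).subset ?_
  rintro p ⟨_, hp⟩
  exact le_of_memXMulPadicInt he hf hsum h0 hNlt hx hW hp

theorem mainTheorem1 {q₁ q₂ : ℕ} (e : Fin q₁ → ℕ) (f : Fin q₂ → ℕ)
    (hne : 0 < q₁) (he : ∀ i, 0 < e i) (hf : ∀ j, 0 < f j)
    (hdisj : ∀ i j, e i ≠ f j) (hsum : ∑ i, e i = ∑ j, f j) :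
    ((∀ n : ℕ, ∃ k : ℤ, factorialRatio e f n = k) ↔
        ∀ x ∈ Set.Icc (0 : ℝ) 1, 0 ≤ landauDelta e f x) ∧
    ((∀ n : ℕ, ∃ k : ℤ, factorialRatio e f n = k) →
      ((∀ x ∈ Set.Ico (1 / (maxTerm e f : ℝ)) 1, 1 ≤ landauDelta e f x) ∨
        ∃ x ∈ Set.Ico (1 / (maxTerm e f : ℝ)) 1, landauDelta e f x = 0) ∧
      ((∀ x ∈ Set.Ico (1 / (maxTerm e f : ℝ)) 1, 1 ≤ landauDelta e f x) →
        MemXMulInt (canonicalCoordinate e f)) ∧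
      ((∃ x ∈ Set.Ico (1 / (maxTerm e f : ℝ)) 1, landauDelta e f x = 0) →
        {p : ℕ | ∃ _ : Fact p.Prime, MemXMulPadicInt p (canonicalCoordinate e f)}.Finite)) := by
  have hiff := integral_iff_landauDelta_nonneg he hf hsum
  refine ⟨hiff, fun hint => ?_⟩
  have h0 := hiff.1 hint
  refine ⟨?_, memXMulInt_canonicalCoordinate hsum h0,
    finite_memXMulPadicInt hne he hf hdisj hsum h0⟩
  by_contra! h
  obtain ⟨⟨x, hx, hlt⟩, hnz⟩ := h
  have hxpos : 0 ≤ x := le_trans (by positivity) hx.1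
  exact hnz x hx (le_antisymm (Int.lt_add_one_iff.1 (by simpa using hlt)) (h0 x ⟨hxpos, hx.2.le⟩))
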